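/- **Definitions.** A simply connected stratified group of step at most two is given by its Lie algebra $\mathfrak g=\mathfrak h\oplus\mathfrak v$ (finite-dimensional, real) with an inner product making the layers orthogonal, where $[\mathfrak h,\mathfrak h]=\mathfrak v$, $[\mathfrak g,\mathfrak v]=0$; the abelian case $\mathfrak v=0$ is allowed. Define $J:\mathfrak v\to\operatorname{End}(\mathfrak h)$ by $\langle J(\sigma)z,z'\rangle=\langle[z,z'],\sigma\rangle$. The group is of *Heisenberg type* if $J(\sigma)$ is orthogonal for every unit $\sigma\in\mathfrak v$. Let $\mathscr S(\mathfrak h)$ be the group of all $S\in O(\mathfrak h)$ with $SJ(\sigma)=J(\sigma)S$ for every $\sigma\in\mathfrak v$. The group has *Property (H)* if $\mathscr S(\mathfrak h)$ acts transitively on the unit sphere of $\mathfrak h$. A group of Heisenberg type is of *Iwasawa type* if its Lie algebra is isomorphic to the nilpotent part $\mathfrak n$ in an Iwasawa decomposition $\mathfrak s=\mathfrak k\oplus\mathfrak a\oplus\mathfrak n$ of a simple real Lie algebra $\mathfrak s$ of real rank one ($\dim\mathfrak a=1$), isometrically for the inner product $-c\,B(X,\theta Y)$ on $\mathfrak n$,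 where $B$ is the Killing form, $\theta$ the Cartan involution and $c>0$ a constant. The *octonionic Heisenberg group* has $\mathfrak h=\mathbb O$, $\mathfrak v=\operatorname{Im}\mathbb O$ with their Euclidean inner products and $[x,y]=\operatorname{Im}(\bar x y)$ for $x,y\in\mathbb O$. Let $\mathrm{Spin}(7)\subset SO(8)$ be the group generated by its maps $J(\omega)$, $\omega\in\operatorname{Im}\mathbb O$, $|\omega|=1$. **Proposition.** 1. Let $\mathbb G$ be a group of Iwasawa type that is not isometrically isomorphic to the octonionic Heisenberg group. Then $\mathbb G$ has Property (H). Moreover, one of the following holds: $\mathbb G$ is abelian ($\mathfrak v=0$); or $\dim\mathfrak v=1$ and, under some isometry $\mathfrak h\cong\mathbb C^n$ with $n\ge1$, $\mathscr S(\mathfrak h)=U(n)$; or $\dim\mathfrak v=3$ and, under some isometry $\mathfrak h\cong\mathbb H^n$ with $n\ge1$, $\mathscr S(\mathfrak h)=Sp(n)$, the group of quaternionic unitary matrices acting on column vectors by left multiplication. 2. The octonionic Heisenberg group is of Heisenberg type and has dimension $15$, and it does not have Property (H). For it $\mathscr S(\mathfrak h)=\{\pm I\}$, and the centralizer of $\mathrm{Spin}(7)$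 in $SO(8)$ is $\{\pm I\}$. -/

import Mathlib

open scoped Quaternion RealInnerProductSpace Matrix

noncomputable section

/-! ## Stratified groups of step two, Heisenberg type, Property (H) -/

/-- A simply connected stratified nilpotent Lie group of step (at most) two, given by its Lie algebra
`𝔤 = h ⊕ v` with an inner product for which the layers `h` and `v` are orthogonal. The Lie bracket
of `𝔤` is `[(z, σ), (z', σ')] = (0, bracket z z')`, and `[h, h] = v`. In logarithmic coordinates the
group is `h × v` with the law `(z, σ) (z', σ') = (z + z', σ + σ' + (1/2) bracket z z')`.
The case `v = 0` is the abelian group `h`. -/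
structure StratifiedAlgebra (h v : Type*) [NormedAddCommGroup h] [InnerProductSpace ℝ h]
    [NormedAddCommGroup v] [InnerProductSpace ℝ v] where
  bracket : h →ₗ[ℝ] h →ₗ[ℝ] v
  bracket_self : ∀ z, bracket z z = 0
  span_bracket : Submodule.span ℝ {σ : v | ∃ z z', bracket z z' = σ} = ⊤

namespace StratifiedAlgebra

section Basic

variable {h v : Type*} [NormedAddCommGroup h] [InnerProductSpace ℝ h]
  [NormedAddCommGroup v] [InnerProductSpace ℝ v] (G : StratifiedAlgebra h v)

/-- The Lie bracket of the whole Lie algebra `h ⊕ v`. -/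
def lieBracket (x y : h × v) : h × v := (0, G.bracket x.1 y.1)

variable [FiniteDimensional ℝ h] [FiniteDimensional ℝ v]

/-- The map `J : v → End h`, determined by `⟪J σ z, z'⟫ = ⟪[z, z'], σ⟫` (see `inner_J`). -/
def J (σ : v) : h →ₗ[ℝ] h where
  toFun z := LinearMap.adjoint (G.bracket z) σ
  map_add' x y := by simp
  map_smul' r x := by simp

theorem inner_J (σ : v) (z z' : h) : ⟪G.J σ z, z'⟫ = ⟪G.bracket z z', σ⟫ := by
  rw [real_inner_comm σ]
  exact LinearMap.adjoint_inner_left (G.bracket z) z' σ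

/-- Heisenberg type: `J σ` is orthogonal for every unit vector `σ` of `v`. -/
def IsHeisenbergType : Prop := ∀ σ : v, ‖σ‖ = 1 → ∀ z : h, ‖G.J σ z‖ = ‖z‖

/-- The `J`-invariant orthogonal group `𝒮(h)`: the orthogonal transformations of `h` that commute
with every `J σ`. -/
def invariantOrthogonalGroup : Subgroup (h ≃ₗᵢ[ℝ] h) where
  carrier := {S | ∀ (σ : v) (z : h), S (G.J σ z) = G.J σ (S z)}
  mul_mem' := by
    intro S T hS hT σ z
    change S (T (G.J σ z)) = G.J σ (S (T z))
    rw [hT, hS]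
  one_mem' := fun _ _ => rfl
  inv_mem' := by
    intro S hS σ z
    change S.symm (G.J σ z) = G.J σ (S.symm z)
    rw [LinearIsometryEquiv.symm_apply_eq, hS, LinearIsometryEquiv.apply_symm_apply]

/-- Property (H): `𝒮(h)` acts transitively on the unit sphere of `h`. -/
def PropertyH : Prop :=
  ∀ z w : h, ‖z‖ = 1 → ‖w‖ = 1 → ∃ S ∈ G.invariantOrthogonalGroup, S z = w

end Basic

/-- Isometric isomorphism: isometries of both layers that respect the brackets. -/
def IsIsometricTo {h v h' v' : Type*} [NormedAddCommGroup h] [InnerProductSpace ℝ h]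
    [NormedAddCommGroup v] [InnerProductSpace ℝ v] [NormedAddCommGroup h']
    [InnerProductSpace ℝ h'] [NormedAddCommGroup v'] [InnerProductSpace ℝ v']
    (G : StratifiedAlgebra h v) (G' : StratifiedAlgebra h' v') : Prop :=
  ∃ (e : h ≃ₗᵢ[ℝ] h') (f : v ≃ₗᵢ[ℝ] v'),
    ∀ z z' : h, f (G.bracket z z') = G'.bracket (e z) (e z')

end StratifiedAlgebra

/-! ## The nilpotent part of the Iwasawa decomposition in real rank one -/

/-- A Cartan involution of a real Lie algebra: an involutive automorphism `θ` for which
`-B(X, θ Y)` is positive definite, `B` being the Killing form. -/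
structure IsCartanInvolution {s : Type*} [LieRing s] [LieAlgebra ℝ s]
    (θ : s ≃ₗ⁅ℝ⁆ s) : Prop where
  involutive : ∀ X, θ (θ X) = X
  pos : ∀ X, X ≠ 0 → 0 < -killingForm ℝ s X (θ X)

/-- The line `ℝ A` is a maximal abelian subspace of the `(-1)`-eigenspace `𝔭` of `θ`; in
particular, when `θ` is a Cartan involution, the real rank is one. -/
structure IsMaximalAbelianLine {s : Type*} [LieRing s] [LieAlgebra ℝ s]
    (θ : s ≃ₗ⁅ℝ⁆ s) (A : s) : Prop where
  ne_zero : A ≠ 0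
  mem : θ A = -A
  maximal : ∀ X, θ X = -X → ⁅A, X⁆ = 0 → ∃ r : ℝ, X = r • A

/-- The nilpotent part `𝔫` of the Iwasawa decomposition with `𝔞 = ℝ A` and `A` in the positive
Weyl chamber: the sum of the restricted root spaces of the roots that are positive on `A`. -/
def iwasawaNilpotent {s : Type*} [LieRing s] [LieAlgebra ℝ s] (A : s) : Submodule ℝ s :=
  ⨆ t : {t : ℝ // 0 < t}, Module.End.eigenspace (LieAlgebra.ad ℝ s A) t.1

/-- A group of Iwasawa type: a group of Heisenberg type whose Lie algebra is isomorphic to the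
nilpotent part `𝔫` of the Iwasawa decomposition of a simple real Lie algebra `s` of real rank one,
isometrically for the inner product `-c B(X, θ Y)` on `𝔫`, with some normalizing constant `c > 0`.
(Every finite-dimensional real Lie algebra has a copy in `Type`.) -/
def StratifiedAlgebra.IsIwasawaType {h v : Type*} [NormedAddCommGroup h] [InnerProductSpace ℝ h]
    [NormedAddCommGroup v] [InnerProductSpace ℝ v] [FiniteDimensional ℝ h] [FiniteDimensional ℝ v]
    (G : StratifiedAlgebra h v) : Prop :=
  G.IsHeisenbergType ∧
  ∃ (s : Type) (_ : LieRing s) (_ : LieAlgebra ℝ s) (θ : s ≃ₗ⁅ℝ⁆ s) (A : s)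
    (φ : h × v →ₗ[ℝ] s) (c : ℝ),
    Module.Finite ℝ s ∧ LieAlgebra.IsSimple ℝ s ∧ IsCartanInvolution θ ∧
    IsMaximalAbelianLine θ A ∧
    Function.Injective φ ∧ LinearMap.range φ = iwasawaNilpotent A ∧
    (∀ x y, φ (G.lieBracket x y) = ⁅φ x, φ y⁆) ∧
    0 < c ∧ ∀ x y : h × v,
      ⟪x.1, y.1⟫ + ⟪x.2, y.2⟫ = -(c * killingForm ℝ s (φ x) (θ (φ y)))

/-! ## The octonionic Heisenberg group -/

/-- The octonions as pairs of quaternions, with the Euclidean inner product of `ℝ⁸`. -/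
abbrev Octonion : Type := WithLp 2 (ℍ[ℝ] × ℍ[ℝ])

namespace Octonion

/-- Cayley-Dickson multiplication `(a, b) (c, d) = (a c - d b*, a* d + c b)`. -/
def mul (x y : Octonion) : Octonion :=
  WithLp.toLp 2 (x.fst * y.fst - y.snd * star x.snd, star x.fst * y.snd + y.fst * x.snd)

/-- Octonionic conjugation `(a, b)* = (a*, -b)`. -/
def conj (x : Octonion) : Octonion := WithLp.toLp 2 (star x.fst, -x.snd)

theorem conj_add (x y : Octonion) : conj (x + y) = conj x + conj y := by
  apply (WithLp.equiv 2 _).injective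
  apply Prod.ext
  · simp [conj]
  · simp [conj, add_comm]

theorem conj_smul (r : ℝ) (x : Octonion) : conj (r • x) = r • conj x := by
  apply (WithLp.equiv 2 _).injective
  apply Prod.ext <;> simp [conj]

/-- The purely imaginary octonions. -/
def imaginary : Submodule ℝ Octonion where
  carrier := {x | conj x = -x}
  add_mem' := by
    intro x y hx hy
    change conj (x + y) = -(x + y)
    rw [conj_add, hx, hy]; abel
  zero_mem' := by simp [conj]
  smul_mem' := by
    intro r x hx
    change conj (r • x) = -(r • x)
    rw [conj_smul, hx, smul_neg]

/-- The imaginary part `Im x = (x - x*) / 2`. -/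
def im (x : Octonion) : imaginary :=
  ⟨(1 / 2 : ℝ) • (x - conj x), by
    change conj _ = -_
    apply (WithLp.equiv 2 _).injective
    ext <;> simp [conj] <;> ring⟩

theorem add_mul (x x' y : Octonion) : mul (x + x') y = mul x y + mul x' y := by
  apply (WithLp.equiv 2 _).injective
  apply Prod.ext <;> simp [mul, _root_.add_mul, _root_.mul_add] <;> abel

theorem mul_add (x y y' : Octonion) : mul x (y + y') = mul x y + mul x y' := by
  apply (WithLp.equiv 2 _).injective
  apply Prod.ext <;> simp [mul, _root_.add_mul, _root_.mul_add] <;> abel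

theorem smul_mul (r : ℝ) (x y : Octonion) : mul (r • x) y = r • mul x y := by
  apply (WithLp.equiv 2 _).injective
  apply Prod.ext <;> simp [mul, smul_sub]

theorem mul_smul (r : ℝ) (x y : Octonion) : mul x (r • y) = r • mul x y := by
  apply (WithLp.equiv 2 _).injective
  apply Prod.ext <;> simp [mul, smul_sub]

theorem im_add (x y : Octonion) : im (x + y) = im x + im y := by
  apply Subtype.ext
  change (1 / 2 : ℝ) • (x + y - conj (x + y)) =
    (1 / 2 : ℝ) • (x - conj x) + (1 / 2 : ℝ) • (y - conj y)
  rw [conj_add]; module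

theorem im_smul (r : ℝ) (x : Octonion) : im (r • x) = r • im x := by
  apply Subtype.ext
  change (1 / 2 : ℝ) • (r • x - conj (r • x)) = r • (1 / 2 : ℝ) • (x - conj x)
  rw [conj_smul]; module

/-- The bracket `Im (x* y)`. -/
def bracket : Octonion →ₗ[ℝ] Octonion →ₗ[ℝ] imaginary :=
  LinearMap.mk₂ ℝ (fun x y => im (mul (conj x) y))
    (fun x x' y => by rw [conj_add, add_mul, im_add])
    (fun r x y => by rw [conj_smul, smul_mul, im_smul])
    (fun x y y' => by rw [mul_add, im_add])
    (fun r x y => by rw [mul_smul, im_smul])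

end Octonion

/-- The 15-dimensional octonionic Heisenberg group: `h` is the space of octonions, `v` the space of
imaginary octonions, and `[x, y] = Im (x* y)`. -/
def octonionicHeisenberg : StratifiedAlgebra Octonion Octonion.imaginary where
  bracket := Octonion.bracket
  bracket_self := by
    intro x
    apply Subtype.ext
    change (1 / 2 : ℝ) • (Octonion.mul (Octonion.conj x) x -
      Octonion.conj (Octonion.mul (Octonion.conj x) x)) = 0
    have h1 : Octonion.conj (Octonion.mul (Octonion.conj x) x) =
        Octonion.mul (Octonion.conj x) x := by
      apply (WithLp.equiv 2 _).injective
      apply Prod.ext <;> simp [Octonion.mul, Octonion.conj]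
    rw [h1, sub_self, smul_zero]
  span_bracket := by
    rw [eq_top_iff]
    rintro ⟨σ, hσ⟩ -
    refine Submodule.subset_span ⟨WithLp.toLp 2 (1, 0), σ, ?_⟩
    apply Subtype.ext
    change Octonion.conj σ = -σ at hσ
    have h1 : Octonion.mul (Octonion.conj (WithLp.toLp 2 (1, 0))) σ = σ := by
      apply (WithLp.equiv 2 _).injective
      apply Prod.ext <;> simp [Octonion.mul, Octonion.conj]
    change (1 / 2 : ℝ) • (Octonion.mul (Octonion.conj (WithLp.toLp 2 (1, 0))) σ -
      Octonion.conj (Octonion.mul (Octonion.conj (WithLp.toLp 2 (1, 0))) σ)) = σ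
    rw [h1, hσ, sub_neg_eq_add, ← two_smul ℝ σ, smul_smul]
    norm_num

/-- The group `Spin(7)` inside the orthogonal group of `ℝ⁸`, generated by the maps `J ω` of the
octonionic Heisenberg group with `ω` a unit imaginary octonion. -/
def spinSeven : Subgroup (Octonion ≃ₗᵢ[ℝ] Octonion) :=
  Subgroup.closure {T | ∃ ω : Octonion.imaginary, ‖ω‖ = 1 ∧
    ∀ z, T z = octonionicHeisenberg.J ω z}

/-! ## Standard actions of `U(n)` and `Sp(n)` -/

/-- For `K = ℂ` or `K = ℍ`, the isometry `S` of `h` is, in the coordinates `e : h ≃ Kⁿ`, left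
multiplication of column vectors by a matrix `U` over `K` with `U* U = U U* = 1`. -/
def IsUnitaryIn {h K : Type*} [NormedAddCommGroup h] [InnerProductSpace ℝ h] [NormedRing K]
    [StarRing K] [NormedAlgebra ℝ K] {n : ℕ} (e : h ≃ₗᵢ[ℝ] PiLp 2 (fun _ : Fin n => K))
    (S : h ≃ₗᵢ[ℝ] h) : Prop :=
  ∃ U ∈ unitary (Matrix (Fin n) (Fin n) K),
    ∀ z, e (S z) = WithLp.toLp 2 (U *ᵥ WithLp.ofLp (e z))

end

/-! The Iwasawa hypothesis enters only through the `J²` condition: if `σ ⟂ τ`, then `J σ (J τ z) = J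
ρ z` for some `ρ` depending on `z`. To derive it, `𝔫` is graded by a root and its double
(`exists_grading`), so that `⁅σ, θ z⁆ = J σ z`. The Jacobi identity and the maximality of `ℝ A` then
determine the triple product `⁅⁅x, θ y⁆, u⁆` on `h`. Comparing this formula with the derivation
property of `⁅z, θ w⁆` gives the condition in its dual form
(`IsIwasawaEmbedding.bracket_J_eq_zero`).

The `J²` condition leaves few possibilities for `v`. One unit vector gives a complex structure on
`h`. Two orthonormal vectors produce a third, and if these three span `v` they give a quaternionic
structure. A fourth produces exactly seven and forces `h = ℝ z + J v z`, which is the octonionic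
group (`exists_octonionicAt`, `isIsometricTo_octonionicHeisenberg`).

In the complex and quaternionic cases `h` is a free right `K`-module with compatible norm. An
orthonormal `K`-basis can start at any unit vector, which gives transitivity, and in such a basis
`𝒮(h)` is the unitary group over `K` (`propertyH_and_unitary`). For the octonions, commuting with
all `J ω` forces the image of `1` to associate with enough imaginary units to be real, so only `±1`
remain. -/

namespace StratifiedAlgebra

/-! ### Identities for `J` in groups of Heisenberg type. -/

variable {h v : Type*} [NormedAddCommGroup h] [InnerProductSpace ℝ h]
  [NormedAddCommGroup v] [InnerProductSpace ℝ v] (G : StratifiedAlgebra h v)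

theorem bracket_swap (z w : h) : G.bracket z w = -G.bracket w z := by
  have h0 := G.bracket_self (z + w)
  simp only [map_add, LinearMap.add_apply, G.bracket_self, zero_add, add_zero] at h0
  exact eq_neg_of_add_eq_zero_right h0

include G in
theorem nontrivial_of_nontrivial [Nontrivial v] : Nontrivial h := by
  by_contra hc
  rw [not_nontrivial_iff_subsingleton] at hc
  obtain ⟨σ, hσ⟩ := exists_ne (0 : v)
  have h2 : Submodule.span ℝ {σ : v | ∃ z z', G.bracket z z' = σ} ≤ ⊥ := by
    rw [Submodule.span_le]
    rintro _ ⟨z, w, rfl⟩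
    simp [Subsingleton.elim z 0]
  rw [G.span_bracket] at h2
  exact hσ ((Submodule.mem_bot ℝ).mp (h2 (Submodule.mem_top (x := σ))))

variable [FiniteDimensional ℝ h] [FiniteDimensional ℝ v]

theorem J_add (σ τ : v) (z : h) : G.J (σ + τ) z = G.J σ z + G.J τ z := by simp [J]

theorem J_smul (r : ℝ) (σ : v) (z : h) : G.J (r • σ) z = r • G.J σ z := by simp [J]

theorem J_zero (z : h) : G.J 0 z = 0 := by simp [J]

theorem J_neg (σ : v) (z : h) : G.J (-σ) z = -G.J σ z := by simp [J]

theorem inner_J_right (σ : v) (z w : h) : ⟪z, G.J σ w⟫ = -⟪G.J σ z, w⟫ := by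
  rw [real_inner_comm, inner_J, inner_J, bracket_swap, inner_neg_left]

theorem inner_J_self (σ : v) (z : h) : ⟪G.J σ z, z⟫ = 0 := by
  rw [inner_J, bracket_self, inner_zero_left]

variable {G} (hG : G.IsHeisenbergType)
include hG

namespace IsHeisenbergType

theorem norm_J (σ : v) (z : h) : ‖G.J σ z‖ = ‖σ‖ * ‖z‖ := by
  rcases eq_or_ne σ 0 with rfl | hσ
  · simp [J_zero]
  · have h1 : ‖σ‖ ≠ 0 := norm_ne_zero_iff.mpr hσ
    have h2 := hG (‖σ‖⁻¹ • σ) (by rw [norm_smul, norm_inv, norm_norm, inv_mul_cancel₀ h1]) z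
    rw [J_smul, norm_smul, norm_inv, norm_norm] at h2
    rw [← h2, mul_inv_cancel_left₀ h1]

theorem inner_J_J_self (σ : v) (z w : h) : ⟪G.J σ z, G.J σ w⟫ = ‖σ‖ ^ 2 * ⟪z, w⟫ := by
  have e := hG.norm_J σ (z + w)
  have e' : ‖G.J σ (z + w)‖ ^ 2 = ‖σ‖ ^ 2 * ‖z + w‖ ^ 2 := by rw [e]; ring
  rw [map_add, norm_add_sq_real, norm_add_sq_real, hG.norm_J, hG.norm_J] at e'
  linarith

theorem inner_J_J_add (σ τ : v) (z w : h) :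
    ⟪G.J σ z, G.J τ w⟫ + ⟪G.J τ z, G.J σ w⟫ = 2 * ⟪σ, τ⟫ * ⟪z, w⟫ := by
  have e := hG.inner_J_J_self (σ + τ) z w
  rw [norm_add_sq_real, J_add, J_add, inner_add_left, inner_add_right, inner_add_right,
    hG.inner_J_J_self, hG.inner_J_J_self] at e
  linarith

theorem inner_J_J (σ τ : v) (z : h) : ⟪G.J σ z, G.J τ z⟫ = ⟪σ, τ⟫ * ‖z‖ ^ 2 := by
  have e := hG.inner_J_J_add σ τ z z
  rw [real_inner_comm (G.J σ z) (G.J τ z), real_inner_self_eq_norm_sq] at e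
  linarith

theorem bracket_J (σ : v) (z : h) : G.bracket z (G.J σ z) = ‖z‖ ^ 2 • σ := by
  refine ext_inner_right ℝ fun τ => ?_
  rw [← inner_J, hG.inner_J_J, inner_smul_left, real_inner_comm σ τ]
  simp [mul_comm]

/-- The Clifford relations. They come from polarizing `‖J σ z‖ = ‖σ‖ ‖z‖` in both variables and
moving one `J` across the inner product by skew-symmetry. -/
theorem J_J_add (σ τ : v) (z : h) :
    G.J σ (G.J τ z) + G.J τ (G.J σ z) = -(2 * ⟪σ, τ⟫) • z := by
  refine ext_inner_right ℝ fun w => ?_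
  have e := hG.inner_J_J_add σ τ z w
  rw [inner_J_right, inner_J_right] at e
  rw [inner_add_left, real_inner_smul_left]
  linarith

theorem J_J_self (σ : v) (z : h) : G.J σ (G.J σ z) = -(‖σ‖ ^ 2) • z := by
  have e := hG.J_J_add σ σ z
  rw [real_inner_self_eq_norm_sq, ← two_smul ℝ] at e
  have : (2 : ℝ) • G.J σ (G.J σ z) = (2 : ℝ) • (-(‖σ‖ ^ 2) • z) := by rw [e]; module
  exact smul_right_injective h (two_ne_zero (α := ℝ)) this

theorem J_J_of_orthogonal {σ τ : v} (hστ : ⟪σ, τ⟫ = 0) (z : h) :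
    G.J σ (G.J τ z) = -G.J τ (G.J σ z) := by
  have e := hG.J_J_add σ τ z
  rw [hστ] at e
  exact eq_neg_of_add_eq_zero_left (by simpa using e)

theorem eq_zero_of_J_eq_zero {σ : v} {z : h} (hz : z ≠ 0) (e : G.J σ z = 0) : σ = 0 := by
  have := hG.norm_J σ z
  rw [e, norm_zero] at this
  rcases mul_eq_zero.mp this.symm with h1 | h1
  · exact norm_eq_zero.mp h1
  · exact absurd (norm_eq_zero.mp h1) hz

end IsHeisenbergType
end StratifiedAlgebra

/-! ### Eigenvalues of symmetric maps. -/

theorem LinearMap.IsSymmetric.eq_smul_id {E : Type*} [NormedAddCommGroup E]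
    [InnerProductSpace ℝ E] [FiniteDimensional ℝ E] {T : E →ₗ[ℝ] E} (hT : T.IsSymmetric) (s : ℝ)
    (hs : ∀ (t : ℝ) (x : E), x ≠ 0 → T x = t • x → t = s) (x : E) : T x = s • x := by
  have : T = s • LinearMap.id := by
    refine (hT.eigenvectorBasis rfl).toBasis.ext fun i => ?_
    have e := hT.apply_eigenvectorBasis rfl i
    simp only [RCLike.ofReal_real_eq_id, id_eq] at e
    rw [OrthonormalBasis.coe_toBasis]
    have hne : hT.eigenvectorBasis rfl i ≠ 0 := by
      rw [← norm_ne_zero_iff, (hT.eigenvectorBasis rfl).orthonormal.norm_eq_one]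
      exact one_ne_zero
    rw [e, hs _ _ hne e]
    rfl
  rw [this]
  rfl

/-- Without eigenvectors the hypothesis of `eq_smul_id` holds vacuously for the value `0`; the map
then vanishes and every nonzero vector is an eigenvector after all. -/
theorem LinearMap.IsSymmetric.exists_eigenvector {E : Type*} [NormedAddCommGroup E]
    [InnerProductSpace ℝ E] [FiniteDimensional ℝ E] [Nontrivial E] {T : E →ₗ[ℝ] E}
    (hT : T.IsSymmetric) : ∃ (t : ℝ) (x : E), x ≠ 0 ∧ T x = t • x := by
  by_contra! hc
  obtain ⟨x, hx⟩ := exists_ne (0 : E)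
  refine hc 0 x hx (hT.eq_smul_id 0 (fun t y hy e => (hc t y hy e).elim) x)

/-! ### From the Iwasawa decomposition to the `J²` condition. -/

/-- The data that exhibit `G` as the nilpotent part of an Iwasawa decomposition. -/
structure IsIwasawaEmbedding {h v : Type*} [NormedAddCommGroup h] [InnerProductSpace ℝ h]
    [NormedAddCommGroup v] [InnerProductSpace ℝ v] (G : StratifiedAlgebra h v)
    {s : Type*} [LieRing s] [LieAlgebra ℝ s] (θ : s ≃ₗ⁅ℝ⁆ s) (A : s) (φ : h × v →ₗ[ℝ] s)
    (c : ℝ) : Prop where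
  cartan : IsCartanInvolution θ
  line : IsMaximalAbelianLine θ A
  injective : Function.Injective φ
  range_eq : LinearMap.range φ = iwasawaNilpotent A
  map_bracket : ∀ x y, φ (G.lieBracket x y) = ⁅φ x, φ y⁆
  pos : 0 < c
  isometric : ∀ x y : h × v,
    ⟪x.1, y.1⟫ + ⟪x.2, y.2⟫ = -(c * killingForm ℝ s (φ x) (θ (φ y)))

namespace IsIwasawaEmbedding

open StratifiedAlgebra

variable {h v : Type*} [NormedAddCommGroup h] [InnerProductSpace ℝ h]
  [NormedAddCommGroup v] [InnerProductSpace ℝ v] {G : StratifiedAlgebra h v}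
  {s : Type*} [LieRing s] [LieAlgebra ℝ s] {θ : s ≃ₗ⁅ℝ⁆ s} {A : s} {φ : h × v →ₗ[ℝ] s} {c : ℝ}
  (E : IsIwasawaEmbedding G θ A φ c)
include E

theorem lie_horizontal (z w : h) : ⁅φ (z, 0), φ (w, 0)⁆ = φ (0, G.bracket z w) := by
  rw [← E.map_bracket]; rfl

theorem lie_vertical (x : h × v) (σ : v) : ⁅φ x, φ (0, σ)⁆ = 0 := by
  rw [← E.map_bracket]
  simp only [lieBracket, map_zero]
  exact map_zero φ

theorem lie_θ (x y : s) : ⁅x, θ y⁆ = θ ⁅θ x, y⁆ := by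
  rw [LieEquiv.map_lie, E.cartan.involutive]

theorem lie_A_θ (x : s) : ⁅A, θ x⁆ = -θ ⁅A, x⁆ := by
  rw [E.lie_θ, E.line.mem, neg_lie, map_neg]

theorem mem_range_of_eigen {t : ℝ} (ht : 0 < t) {X : s} (hX : ⁅A, X⁆ = t • X) : ∃ x, φ x = X := by
  have : X ∈ LinearMap.range φ := by
    rw [E.range_eq]
    exact Submodule.mem_iSup_of_mem (⟨t, ht⟩ : {t : ℝ // 0 < t})
      (Module.End.mem_eigenspace_iff.mpr hX)
  exact this

theorem killing_A_pos : 0 < killingForm ℝ s A A := by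
  have := E.cartan.pos A E.line.ne_zero
  rwa [E.line.mem, map_neg, neg_neg] at this

theorem exists_lie_A (x : h × v) : ∃ y, φ y = ⁅A, φ x⁆ := by
  have hx : φ x ∈ iwasawaNilpotent A := E.range_eq ▸ LinearMap.mem_range_self φ x
  have : ⁅A, φ x⁆ ∈ LinearMap.range φ := by
    refine Submodule.iSup_induction _ (motive := fun X => ⁅A, X⁆ ∈ LinearMap.range φ) hx ?_ ?_ ?_
    · intro t X hX
      have hX' : ⁅A, X⁆ = t.1 • X := Module.End.mem_eigenspace_iff.mp hX
      obtain ⟨y, rfl⟩ := E.mem_range_of_eigen t.2 hX'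
      exact ⟨t.1 • y, by rw [hX', map_smul]⟩
    · simp
    · intro X Y hX hY
      rw [lie_add]
      exact add_mem hX hY
  exact this

/-- The element `A` acts on `h ⊕ v` by symmetric maps of the two layers. -/
theorem exists_symmetric [FiniteDimensional ℝ h] [FiniteDimensional ℝ v] :
    ∃ (S : h →ₗ[ℝ] h) (T : v →ₗ[ℝ] v), S.IsSymmetric ∧ T.IsSymmetric ∧
      (∀ z, ⁅A, φ (z, 0)⁆ = φ (S z, 0)) ∧ ∀ σ, ⁅A, φ (0, σ)⁆ = φ (0, T σ) := by
  obtain ⟨g, hg⟩ := LinearMap.exists_leftInverse_of_injective φ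
    (LinearMap.ker_eq_bot.mpr E.injective)
  have hg' : ∀ x, g (φ x) = x := fun x => LinearMap.congr_fun hg x
  let D : h × v →ₗ[ℝ] h × v := g ∘ₗ LieAlgebra.ad ℝ s A ∘ₗ φ
  have hD : ∀ x, φ (D x) = ⁅A, φ x⁆ := by
    intro x
    obtain ⟨y, hy⟩ := E.exists_lie_A x
    change φ (g ⁅A, φ x⁆) = _
    rw [← hy, hg']
  -- Invariance of the Killing form makes `ad A` skew for it; the sign is undone by `θ A = -A`.
  have hsymm : ∀ x y, ⟪(D x).1, y.1⟫ + ⟪(D x).2, y.2⟫ = ⟪x.1, (D y).1⟫ + ⟪x.2, (D y).2⟫ := by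
    intro x y
    rw [E.isometric, E.isometric, hD, hD]
    congr 2
    have h1 : ⁅A, φ x⁆ = -⁅φ x, A⁆ := (lie_skew _ _).symm
    have h2 : θ ⁅A, φ y⁆ = -⁅A, θ (φ y)⁆ := by rw [E.lie_A_θ, neg_neg]
    rw [h1, h2, map_neg, map_neg, LinearMap.neg_apply, LieModule.traceForm_apply_lie_apply]
  -- `ad A` is a derivation, so it preserves `v`, the span of the brackets. By symmetry it then
  -- preserves the orthogonal complement `h`.
  have hv : ∀ σ : v, (D (0, σ)).1 = 0 := by
    intro σ
    have hσ : σ ∈ Submodule.span ℝ {σ : v | ∃ z z', G.bracket z z' = σ} := by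
      rw [G.span_bracket]; trivial
    induction hσ using Submodule.span_induction with
    | mem τ hτ =>
      obtain ⟨z, w, rfl⟩ := hτ
      have e : φ (D (0, G.bracket z w)) =
          φ (G.lieBracket (D (z, 0)) (w, 0) + G.lieBracket (z, 0) (D (w, 0))) := by
        rw [hD, map_add, E.map_bracket, E.map_bracket, hD, hD, ← E.lie_horizontal, leibniz_lie]
      rw [E.injective e]
      simp [lieBracket]
    | zero =>
      change (D 0).1 = 0
      simp
    | add a b _ _ ha hb =>
      have : ((0 : h), a + b) = (0, a) + (0, b) := by simp
      rw [this, map_add, Prod.fst_add, ha, hb, add_zero]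
    | smul r a _ ha =>
      have : ((0 : h), r • a) = r • (0, a) := by simp
      rw [this, map_smul, Prod.smul_fst, ha, smul_zero]
  have hh : ∀ z : h, (D (z, 0)).2 = 0 := by
    intro z
    refine ext_inner_right ℝ fun σ => ?_
    have := hsymm (z, 0) (0, σ)
    simpa [hv] using this
  refine ⟨LinearMap.fst ℝ h v ∘ₗ D ∘ₗ LinearMap.inl ℝ h v,
    LinearMap.snd ℝ h v ∘ₗ D ∘ₗ LinearMap.inr ℝ h v, ?_, ?_, ?_, ?_⟩
  · intro z w
    simpa using hsymm (z, 0) (w, 0)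
  · intro z w
    simpa using hsymm (0, z) (0, w)
  · intro z
    rw [← hD]
    congr 1
    exact Prod.ext rfl (hh z)
  · intro z
    rw [← hD]
    congr 1
    exact Prod.ext (hv z) rfl

/-- This identifies the orthogonal projection of `⁅σ, θ z⁆` to `𝔫` as `J σ z`. Invariance of the
Killing form leaves only the bracket of `z` with `x`, which lies in `𝔫`. -/
theorem killing_lie_θ [FiniteDimensional ℝ h] [FiniteDimensional ℝ v] (σ : v) (z : h) (x : h × v) :
    -(c * killingForm ℝ s ⁅φ (0, σ), θ (φ (z, 0))⁆ (θ (φ x))) = ⟪G.J σ z, x.1⟫ := by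
  rw [LieModule.traceForm_apply_lie_apply, ← LieEquiv.map_lie, ← E.map_bracket, inner_J]
  have := E.isometric (0, σ) (G.lieBracket (z, 0) x)
  rw [← this]
  simp [lieBracket, real_inner_comm]

theorem lie_θ_eq_of_mem_range [FiniteDimensional ℝ h] [FiniteDimensional ℝ v] {σ : v} {z : h}
    (hm : ∃ x, φ x = ⁅φ (0, σ), θ (φ (z, 0))⁆) :
    ⁅φ (0, σ), θ (φ (z, 0))⁆ = φ (G.J σ z, 0) := by
  obtain ⟨x, hx⟩ := hm
  rw [← hx]
  congr 1
  have key : ∀ y : h × v, ⟪x.1, y.1⟫ + ⟪x.2, y.2⟫ = ⟪G.J σ z, y.1⟫ := by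
    intro y
    rw [E.isometric, hx, E.killing_lie_θ]
  refine Prod.ext (ext_inner_right ℝ fun w => ?_) (ext_inner_right ℝ fun τ => ?_)
  · simpa using key (w, 0)
  · simpa using key (0, τ)

/-- The left side is reversed by `θ`, and it commutes with `A` because the weights `t` and `-t`
cancel. Maximality makes it a multiple of `A`; pairing with `A` gives the coefficient. -/
theorem lie_add_lie_θ {t : ℝ} {x y : h × v} (hx : ⁅A, φ x⁆ = t • φ x) (hy : ⁅A, φ y⁆ = t • φ y) :
    ⁅φ x, θ (φ y)⁆ + ⁅φ y, θ (φ x)⁆ =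
      -((2 * t * (⟪x.1, y.1⟫ + ⟪x.2, y.2⟫)) / (c * killingForm ℝ s A A)) • A := by
  have hθ : ∀ x, ⁅A, φ x⁆ = t • φ x → ⁅A, θ (φ x)⁆ = -(t • θ (φ x)) := by
    intro x hx
    rw [E.lie_A_θ, hx, map_smul]
  have comm : ∀ x y, ⁅A, φ x⁆ = t • φ x → ⁅A, φ y⁆ = t • φ y → ⁅A, ⁅φ x, θ (φ y)⁆⁆ = 0 := by
    intro x y hx hy
    rw [leibniz_lie, hx, hθ y hy]
    simp
  have hk : ∀ x y, ⁅A, φ y⁆ = t • φ y →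
      c * killingForm ℝ s ⁅φ x, θ (φ y)⁆ A = -(t * (⟪x.1, y.1⟫ + ⟪x.2, y.2⟫)) := by
    intro x y hy
    rw [LieModule.traceForm_apply_lie_apply, ← lie_skew, hθ y hy, neg_neg, map_smul, E.isometric]
    simp only [smul_eq_mul]
    ring
  obtain ⟨r, hr⟩ := E.line.maximal (⁅φ x, θ (φ y)⁆ + ⁅φ y, θ (φ x)⁆) (by
    rw [map_add, LieEquiv.map_lie, LieEquiv.map_lie, E.cartan.involutive, E.cartan.involutive,
      ← lie_skew (φ y), ← lie_skew (φ x)]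
    abel) (by rw [lie_add, comm x y hx hy, comm y x hy hx, add_zero])
  have e : c * killingForm ℝ s (⁅φ x, θ (φ y)⁆ + ⁅φ y, θ (φ x)⁆) A =
      -(2 * t * (⟪x.1, y.1⟫ + ⟪x.2, y.2⟫)) := by
    rw [map_add, LinearMap.add_apply, mul_add, hk x y hy, hk y x hx, real_inner_comm x.1,
      real_inner_comm x.2]
    ring
  rw [hr]
  congr 1
  rw [hr, map_smul, LinearMap.smul_apply, smul_eq_mul] at e
  have h1 := E.killing_A_pos.ne'
  have h2 := E.pos.ne'
  field_simp
  linarith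

variable [FiniteDimensional ℝ h] [FiniteDimensional ℝ v] (hG : G.IsHeisenbergType)
include hG

/-- The bracket has weight `a - t`. If this weight were not positive, the bracket would be
orthogonal to all positive root spaces, and its projection `J σ z` to `𝔫` would vanish. Hence it
lies in `𝔫` and equals that projection. -/
theorem lie_θ_eq_of_eigen {a t : ℝ} {σ : v} {z : h} (hσ0 : σ ≠ 0) (hz0 : z ≠ 0)
    (hσ : ⁅A, φ (0, σ)⁆ = a • φ (0, σ)) (hz : ⁅A, φ (z, 0)⁆ = t • φ (z, 0)) :
    t < a ∧ ⁅A, ⁅φ (0, σ), θ (φ (z, 0))⁆⁆ = (a - t) • ⁅φ (0, σ), θ (φ (z, 0))⁆ ∧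
    ⁅φ (0, σ), θ (φ (z, 0))⁆ = φ (G.J σ z, 0) := by
  set Y := ⁅φ (0, σ), θ (φ (z, 0))⁆ with hY
  have hAY : ⁅A, Y⁆ = (a - t) • Y := by
    rw [hY, leibniz_lie, hσ, E.lie_A_θ, hz, smul_lie, map_smul, lie_neg, lie_smul]
    module
  have hpos : t < a := by
    by_contra! hle
    have hzero : ∀ X ∈ iwasawaNilpotent A, killingForm ℝ s Y (θ X) = 0 := by
      intro X hX
      refine Submodule.iSup_induction _ (motive := fun X => killingForm ℝ s Y (θ X) = 0) hX ?_ ?_ ?_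
      · intro u X hX
        have hX' : ⁅A, X⁆ = u.1 • X := Module.End.mem_eigenspace_iff.mp hX
        have e : killingForm ℝ s ⁅Y, A⁆ (θ X) = killingForm ℝ s Y ⁅A, θ X⁆ :=
          LieModule.traceForm_apply_lie_apply ..
        rw [← lie_skew, hAY, E.lie_A_θ, hX', map_smul, map_neg, map_neg, map_smul,
          LinearMap.neg_apply, map_smul, LinearMap.smul_apply, smul_eq_mul, smul_eq_mul] at e
        have h2 := u.2
        have : (a - t - u.1) * killingForm ℝ s Y (θ X) = 0 := by linarith
        rcases mul_eq_zero.mp this with h | h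
        · linarith
        · exact h
      · simp
      · intro X X' h1 h2
        rw [map_add, map_add, h1, h2, add_zero]
    have hJ : G.J σ z = 0 := by
      rw [← inner_self_eq_zero (𝕜 := ℝ)]
      rw [← E.killing_lie_θ σ z (G.J σ z, 0), hzero _ (E.range_eq ▸ LinearMap.mem_range_self φ _)]
      simp
    exact hσ0 (hG.eq_zero_of_J_eq_zero hz0 hJ)
  exact ⟨hpos, hAY, E.lie_θ_eq_of_mem_range (E.mem_range_of_eigen (by linarith) hAY)⟩

/-- Two evaluations of `⁅⁅z, θ z⁆, σ⁆` are compared: the inner bracket is a multiple of `A`, while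
Jacobi gives `-⁅z, J σ z⁆ = -‖z‖² σ`. Since the product of weights is the same for all eigenvectors,
each layer has a single weight. -/
theorem eigen_mul {a t : ℝ} {σ : v} {z : h} (hσ0 : σ ≠ 0) (hz0 : z ≠ 0)
    (hσ : ⁅A, φ (0, σ)⁆ = a • φ (0, σ)) (hz : ⁅A, φ (z, 0)⁆ = t • φ (z, 0)) :
    t * a = c * killingForm ℝ s A A := by
  obtain ⟨-, -, hJ⟩ := E.lie_θ_eq_of_eigen hG hσ0 hz0 hσ hz
  have h1 := E.lie_add_lie_θ hz hz
  have h0 : ⁅φ (z, 0), φ (0, σ)⁆ = 0 := E.lie_vertical _ σ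
  have h2 : ⁅⁅φ (z, 0), θ (φ (z, 0))⁆, φ (0, σ)⁆ = -(‖z‖ ^ 2) • φ (0, σ) := by
    rw [lie_lie, h0, lie_zero, sub_zero, ← lie_skew (θ _), hJ, lie_neg, E.lie_horizontal,
      hG.bracket_J, ← map_smul, ← map_neg]
    congr 1
    simp
  have h3 := congrArg (fun X => ⁅X, φ (0, σ)⁆) h1
  simp only [add_lie, h2, smul_lie, hσ, inner_zero_right, add_zero, real_inner_self_eq_norm_sq] at h3
  have hne : φ (0, σ) ≠ 0 := by
    intro h
    have := E.injective (h.trans (map_zero φ).symm)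
    exact hσ0 (congrArg Prod.snd this)
  rw [← sub_eq_zero, smul_smul, ← add_smul, ← sub_smul] at h3
  have h4 := (smul_eq_zero.mp h3).resolve_right hne
  have h5 := E.killing_A_pos.ne'
  have h6 := E.pos.ne'
  have h7 := norm_ne_zero_iff.mpr hz0
  field_simp at h4
  have h8 : ‖z‖ ^ 2 * (t * a - c * killingForm ℝ s A A) = 0 := by linarith
  have := (mul_eq_zero.mp h8).resolve_left (pow_ne_zero 2 h7)
  linarith

/-- The layers are the root spaces of a root and its double. -/
theorem exists_grading [Nontrivial v] :
    ∃ t : ℝ, 0 < t ∧ 2 * t ^ 2 = c * killingForm ℝ s A A ∧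
      (∀ z, ⁅A, φ (z, 0)⁆ = t • φ (z, 0)) ∧
      ∀ σ z, ⁅φ (0, σ), θ (φ (z, 0))⁆ = φ (G.J σ z, 0) := by
  obtain ⟨S, T, hS, hT, hS', hT'⟩ := E.exists_symmetric
  have hN : 0 < c * killingForm ℝ s A A := mul_pos E.pos E.killing_A_pos
  have eS : ∀ {t : ℝ} {z : h}, S z = t • z → ⁅A, φ (z, 0)⁆ = t • φ (z, 0) := by
    intro t z e
    rw [hS', e, ← map_smul]; simp
  have eT : ∀ {t : ℝ} {z : v}, T z = t • z → ⁅A, φ (0, z)⁆ = t • φ (0, z) := by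
    intro t z e
    rw [hT', e, ← map_smul]; simp
  obtain ⟨a, σ, hσ0, hσ⟩ := hT.exists_eigenvector
  have hnt : Nontrivial h := G.nontrivial_of_nontrivial
  obtain ⟨t, z, hz0, hz⟩ := hS.exists_eigenvector
  have hta := E.eigen_mul hG hσ0 hz0 (eT hσ) (eS hz)
  have ht0 : t ≠ 0 := by rintro rfl; linarith
  have ha0 : a ≠ 0 := by rintro rfl; linarith
  have hSt : ∀ w, S w = t • w := hS.eq_smul_id t fun u w hw e => by
    have := E.eigen_mul hG hσ0 hw (eT hσ) (eS e)
    exact mul_right_cancel₀ ha0 (this.trans hta.symm)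
  have hTa : ∀ w, T w = a • w := hT.eq_smul_id a fun u w hw e => by
    have := E.eigen_mul hG hw hz0 (eT e) (eS hz)
    exact mul_left_cancel₀ ht0 (this.trans hta.symm)
  obtain ⟨h1, h2, h3⟩ := E.lie_θ_eq_of_eigen hG hσ0 hz0 (eT hσ) (eS hz)
  -- `J σ z` has weight `a - t` as a bracket and weight `t` as an element of `h`.
  have h4 : a = 2 * t := by
    rw [h3, eS (hSt _), ← sub_eq_zero, ← sub_smul] at h2
    have hne : φ (G.J σ z, 0) ≠ 0 := by
      intro h
      have := E.injective (h.trans (map_zero φ).symm)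
      exact hσ0 (hG.eq_zero_of_J_eq_zero hz0 (congrArg Prod.fst this))
    have := (smul_eq_zero.mp h2).resolve_right hne
    linarith
  refine ⟨t, by linarith, by rw [← hta, h4]; ring, fun w => eS (hSt w), fun τ w => ?_⟩
  rcases eq_or_ne τ 0 with rfl | hτ
  · have : ((0 : h), (0 : v)) = 0 := rfl
    rw [J_zero, this, map_zero, zero_lie]
  rcases eq_or_ne w 0 with rfl | hw
  · have : ((0 : h), (0 : v)) = 0 := rfl
    rw [map_zero, this, map_zero, map_zero, lie_zero]
  exact (E.lie_θ_eq_of_eigen hG hτ hw (eT (hTa τ)) (eS (hSt w))).2.2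

/-- Put `D = ⁅z, θ w⁆` and `τ = [z, J σ w]`. Computing `⁅D, J σ z⁆` once by the derivation rule and
once by the triple product formula gives values that differ by a nonzero multiple of `J τ z`, so `τ
= 0`. -/
theorem bracket_J_eq_zero {z w : h} (hzw : ⟪z, w⟫ = 0) (hb : G.bracket z w = 0) (σ : v) :
    G.bracket z (G.J σ w) = 0 := by
  rcases eq_or_ne z 0 with rfl | hz0
  · simp
  rcases subsingleton_or_nontrivial v with hv | hv
  · exact Subsingleton.elim _ _
  obtain ⟨t, ht, htc, hA, hJ⟩ := E.exists_grading hG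
  have polar : ∀ x y u : h, ⁅⁅φ (x, 0), θ (φ (y, 0))⁆, φ (u, 0)⁆ +
      ⁅⁅φ (y, 0), θ (φ (x, 0))⁆, φ (u, 0)⁆ = -⟪x, y⟫ • φ (u, 0) := by
    intro x y u
    rw [← add_lie, E.lie_add_lie_θ (hA x) (hA y), smul_lie, hA, smul_smul, ← htc]
    congr 1
    simp only [inner_zero_right, add_zero]
    field_simp
  have jac : ∀ x y u : h, ⁅⁅φ (x, 0), θ (φ (y, 0))⁆, φ (u, 0)⁆ -
      ⁅⁅φ (u, 0), θ (φ (y, 0))⁆, φ (x, 0)⁆ = φ (G.J (G.bracket x u) y, 0) := by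
    intro x y u
    rw [← hJ, ← E.lie_horizontal, lie_lie (φ (x, 0)) (φ (u, 0)),
      ← lie_skew (φ (x, 0)) ⁅φ (u, 0), _⁆, ← lie_skew (φ (u, 0)) ⁅φ (x, 0), _⁆]
    abel
  -- `polar` symmetrizes the triple product in its first two slots and `jac` antisymmetrizes it in
  -- the outer two. Alternating the two relations returns to the original product with the opposite
  -- sign, which yields twice its value.
  have triple : ∀ x y u : h, (2 : ℝ) • ⁅⁅φ (x, 0), θ (φ (y, 0))⁆, φ (u, 0)⁆ =
      -⟪x, y⟫ • φ (u, 0) + ⟪u, x⟫ • φ (y, 0) - ⟪u, y⟫ • φ (x, 0) -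
      φ (G.J (G.bracket y u) x, 0) + φ (G.J (G.bracket x u) y, 0)
      - φ (G.J (G.bracket y x) u, 0) := by
    intro x y u
    linear_combination (norm := module) polar x y u - jac y x u - polar u x y + jac x y u + polar u y x
      - jac y u x
  set τ := G.bracket z (G.J σ w) with hτ
  set D := ⁅φ (z, 0), θ (φ (w, 0))⁆ with hD
  -- Orthogonality of `z` and `w` removes the `A`-component, so `D` is fixed by `θ` and `ad D`
  -- commutes with `θ`.
  have hθD : θ D = D := by
    have e := E.lie_add_lie_θ (hA z) (hA w)
    simp only [hzw, inner_zero_right, add_zero, mul_zero, zero_div, neg_zero, zero_smul] at e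
    rw [hD, LieEquiv.map_lie, E.cartan.involutive, ← lie_skew, eq_comm]
    exact eq_neg_of_add_eq_zero_left e
  have hDz : ⁅D, φ (z, 0)⁆ = (‖z‖ ^ 2 / 2) • φ (w, 0) := by
    have h1 := triple z w z
    rw [bracket_self, bracket_swap G w z, hb, hzw, real_inner_self_eq_norm_sq] at h1
    have h0 : φ ((0 : h), (0 : v)) = 0 := map_zero φ
    simp only [neg_zero, J_zero, h0, zero_smul] at h1
    linear_combination (norm := module) (1 / 2 : ℝ) • h1
  have hDσ : ⁅D, φ (0, σ)⁆ = -φ (0, τ) := by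
    rw [hD, lie_lie, E.lie_vertical, lie_zero, sub_zero, ← lie_skew (θ _), hJ, lie_neg,
      E.lie_horizontal]
  have way1 : ⁅D, φ (G.J σ z, 0)⁆ = -φ (G.J τ z, 0) + (‖z‖ ^ 2 / 2) • φ (G.J σ w, 0) := by
    rw [← hJ, leibniz_lie, hDσ, neg_lie, hJ, E.lie_θ D, hθD, hDz, map_smul, lie_smul, hJ]
  have way2 := triple z w (G.J σ z)
  have e1 : G.bracket w (G.J σ z) = -τ := by
    refine ext_inner_right ℝ fun ρ => ?_
    rw [hτ, inner_neg_left, ← inner_J, ← inner_J]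
    have := hG.inner_J_J_add ρ σ z w
    rw [hzw, real_inner_comm (G.J ρ w)] at this
    linarith
  rw [← hD, way1, hzw, inner_J_self, inner_J, hb, e1, hG.bracket_J, bracket_swap G w z, hb, J_smul,
    J_neg] at way2
  have h0 : φ ((0 : h), (0 : v)) = 0 := map_zero φ
  have hs : φ (‖z‖ ^ 2 • G.J σ w, 0) = ‖z‖ ^ 2 • φ (G.J σ w, 0) := by
    rw [← map_smul φ, Prod.smul_mk, smul_zero]
  have hn : φ (-G.J τ z, 0) = -φ (G.J τ z, 0) := by
    rw [← map_neg φ, Prod.neg_mk, neg_zero]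
  simp only [neg_zero, J_zero, h0, zero_smul, inner_zero_left, hs, hn] at way2
  have h3 : φ (G.J τ z, 0) = 0 := by
    linear_combination (norm := module) (-1 / 3 : ℝ) • way2
  exact hG.eq_zero_of_J_eq_zero hz0
    (congrArg Prod.fst (E.injective (h3.trans (map_zero φ).symm)))

end IsIwasawaEmbedding

/-! ### Right `K`-module structures and unitary matrices. -/

/-- A right action of a normed star ring `K` on a Euclidean space for which the norm is
multiplicative and `star` is the adjoint. -/
structure IsRightAction {h K : Type*} [NormedAddCommGroup h] [InnerProductSpace ℝ h] [NormedRing K]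
    [StarRing K] [NormedAlgebra ℝ K] (R : K →ₗ[ℝ] h →ₗ[ℝ] h) : Prop where
  map_one : ∀ z, R 1 z = z
  map_mul : ∀ a b z, R (a * b) z = R b (R a z)
  norm_map : ∀ a z, ‖R a z‖ = ‖a‖ * ‖z‖
  inner_map : ∀ a z w, ⟪R a z, w⟫ = ⟪z, R (star a) w⟫

namespace IsRightAction

variable {h K : Type*} [NormedAddCommGroup h] [InnerProductSpace ℝ h] [NormedRing K]
    [StarRing K] [NormedAlgebra ℝ K] {R : K →ₗ[ℝ] h →ₗ[ℝ] h} (hR : IsRightAction R)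

/-- The combinations of the vectors `b i` with coefficients acting from the right. -/
noncomputable def combination (R : K →ₗ[ℝ] h →ₗ[ℝ] h) {n : ℕ} (b : Fin n → h) :
    PiLp 2 (fun _ : Fin n => K) →ₗ[ℝ] h where
  toFun x := ∑ i, R (x i) (b i)
  map_add' x y := by simp [Finset.sum_add_distrib]
  map_smul' r x := by simp [Finset.smul_sum]

omit [StarRing K] in
theorem combination_apply {n : ℕ} (b : Fin n → h) (x : PiLp 2 (fun _ : Fin n => K)) :
    combination R b x = ∑ i, R (x i) (b i) := rfl

/-- A family of unit vectors that generate pairwise orthogonal cyclic submodules. -/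
def IsOrthonormalFamily (R : K →ₗ[ℝ] h →ₗ[ℝ] h) {n : ℕ} (b : Fin n → h) : Prop :=
  (∀ i, ‖b i‖ = 1) ∧ ∀ i j, i ≠ j → ∀ a, ⟪R a (b i), b j⟫ = 0

include hR

theorem norm_combination {n : ℕ} {b : Fin n → h} (hb : IsOrthonormalFamily R b)
    (x : PiLp 2 (fun _ : Fin n => K)) : ‖combination R b x‖ = ‖x‖ := by
  have : ‖combination R b x‖ ^ 2 = ‖x‖ ^ 2 := by
    rw [PiLp.norm_sq_eq_of_L2, combination_apply, ← real_inner_self_eq_norm_sq, sum_inner]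
    refine Finset.sum_congr rfl fun i _ => ?_
    rw [inner_sum, Finset.sum_eq_single i]
    · rw [real_inner_self_eq_norm_sq, hR.norm_map, hb.1, mul_one]
    · intro j _ hj
      rw [real_inner_comm, hR.inner_map, ← hR.map_mul, real_inner_comm, hb.2 i j hj.symm]
    · simp
  exact (sq_eq_sq₀ (norm_nonneg _) (norm_nonneg _)).mp this

theorem exists_maximal_family [FiniteDimensional ℝ h] {z : h} (hz : ‖z‖ = 1) :
    ∃ (n : ℕ) (b : Fin (n + 1) → h), b 0 = z ∧ IsOrthonormalFamily R b ∧
      Function.Surjective (combination R b) := by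
  -- The index counts the vectors beyond `z`, so `P n` speaks of families of length `n + 1`.
  let P : ℕ → Prop := fun n => ∃ b : Fin (n + 1) → h, b 0 = z ∧ IsOrthonormalFamily R b
  have hP0 : P 0 := ⟨fun _ => z, rfl, fun _ => hz, fun i j hij =>
    (hij (Fin.ext (by omega))).elim⟩
  have hbound : ∀ n, P n → n < Module.finrank ℝ h := by
    rintro n ⟨b, -, hb⟩
    have ho : Orthonormal ℝ b := ⟨hb.1, fun i j hij => by
      simpa only [hR.map_one] using hb.2 i j hij 1⟩
    have := ho.linearIndependent.fintype_card_le_finrank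
    rw [Fintype.card_fin] at this
    omega
  obtain ⟨n, ⟨b, hb0, hb⟩, hn⟩ : ∃ n, P n ∧ ¬ P (n + 1) := by
    by_contra! hc
    have : ∀ n, P n := fun n => Nat.rec hP0 (fun n ih => hc n ih) n
    exact absurd (hbound _ (this _)) (lt_irrefl _)
  refine ⟨n, b, hb0, hb, ?_⟩
  rw [← LinearMap.range_eq_top]
  by_contra htop
  refine hn ?_
  have hne : (LinearMap.range (combination R b))ᗮ ≠ ⊥ := by
    rwa [Ne, Submodule.orthogonal_eq_bot_iff]
  obtain ⟨u, hu, hu0⟩ := Submodule.exists_mem_ne_zero_of_ne_bot hne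
  -- A vector orthogonal to the range is orthogonal to each cyclic submodule. As the adjoint of `R
  -- a` is `R (star a)`, its own cyclic submodule is orthogonal to them too, and the family can be
  -- extended.
  have hu' : ∀ i a, ⟪R a (b i), u⟫ = 0 := by
    intro i a
    refine hu _ ⟨WithLp.toLp 2 (Pi.single i a), ?_⟩
    rw [combination_apply, Finset.sum_eq_single i]
    · simp
    · intro j _ hj
      simp [Pi.single_eq_of_ne hj]
    · simp
  have hr : ‖u‖ ≠ 0 := norm_ne_zero_iff.mpr hu0
  refine ⟨Fin.snoc b (‖u‖⁻¹ • u), ?_, ?_, ?_⟩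
  · have : (0 : Fin (n + 1 + 1)) = Fin.castSucc 0 := rfl
    rw [this, Fin.snoc_castSucc, hb0]
  · intro i
    refine Fin.lastCases ?_ (fun i => ?_) i
    · rw [Fin.snoc_last, norm_smul, norm_inv, norm_norm, inv_mul_cancel₀ hr]
    · rw [Fin.snoc_castSucc, hb.1]
  · intro i j
    refine Fin.lastCases ?_ (fun i => ?_) i <;> refine Fin.lastCases ?_ (fun j => ?_) j
    · intro hij
      exact (hij rfl).elim
    · intro _ a
      rw [Fin.snoc_castSucc, Fin.snoc_last, hR.inner_map, real_inner_comm, inner_smul_right, hu',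
        mul_zero]
    · intro _ a
      rw [Fin.snoc_castSucc, Fin.snoc_last, inner_smul_right, hu', mul_zero]
    · intro hij a
      rw [Fin.snoc_castSucc, Fin.snoc_castSucc]
      exact hb.2 i j (fun h => hij (by rw [h])) a

/-- Coordinates in which the action is multiplication from the right. -/
theorem exists_coordinates [FiniteDimensional ℝ h] {z : h} (hz : ‖z‖ = 1) :
    ∃ (n : ℕ) (e : h ≃ₗᵢ[ℝ] PiLp 2 (fun _ : Fin (n + 1) => K)),
      e z = WithLp.toLp 2 (Pi.single 0 1) ∧ ∀ a w i, e (R a w) i = e w i * a := by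
  obtain ⟨n, b, hb0, hb, hs⟩ := hR.exists_maximal_family hz
  let f : PiLp 2 (fun _ : Fin (n + 1) => K) ≃ₗᵢ[ℝ] h :=
    LinearIsometryEquiv.ofSurjective ⟨combination R b, hR.norm_combination hb⟩ hs
  have hf : ∀ x, f x = ∑ i, R (x i) (b i) := fun x => rfl
  refine ⟨n, f.symm, ?_, ?_⟩
  · rw [LinearIsometryEquiv.symm_apply_eq, hf, Finset.sum_eq_single 0]
    · simp [hR.map_one, hb0]
    · intro j _ hj
      simp [Pi.single_eq_of_ne hj]
    · simp
  · intro a w i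
    obtain ⟨x, rfl⟩ := f.surjective w
    have : R a (f x) = f (WithLp.toLp 2 fun i => x i * a) := by
      simp only [hf, map_sum, hR.map_mul]
    rw [this, f.symm_apply_apply, f.symm_apply_apply]

/-- Coordinates sending `z` to the first basis vector are composed with the inverse of coordinates
doing the same for `w`. A count of real dimensions shows that both have the same number of entries.
-/
theorem exists_commuting_isometry [FiniteDimensional ℝ h] [FiniteDimensional ℝ K] [Nontrivial K]
    {z w : h} (hz : ‖z‖ = 1) (hw : ‖w‖ = 1) :
    ∃ S : h ≃ₗᵢ[ℝ] h, (∀ a u, S (R a u) = R a (S u)) ∧ S z = w := by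
  obtain ⟨n, e, hez, he⟩ := hR.exists_coordinates hz
  obtain ⟨m, f, hfw, hf⟩ := hR.exists_coordinates hw
  have hfin : ∀ (n : ℕ) (e : h ≃ₗᵢ[ℝ] PiLp 2 (fun _ : Fin (n + 1) => K)),
      Module.finrank ℝ h = (n + 1) * Module.finrank ℝ K := by
    intro n e
    rw [(e.toLinearEquiv.trans (WithLp.linearEquiv 2 ℝ _)).finrank_eq, Module.finrank_pi_fintype]
    simp
  have hnm : n = m := by
    have := (hfin n e).symm.trans (hfin m f)
    have := Nat.eq_of_mul_eq_mul_right (Module.finrank_pos (R := ℝ) (M := K)) this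
    omega
  subst hnm
  refine ⟨e.trans f.symm, fun a u => ?_, ?_⟩
  · apply f.injective
    ext i
    simp [he, hf]
  · simp [hez, ← hfw]

omit hR in
-- Polarization over a possibly noncommutative `K`: the Hermitian matrix `P = Uᴴ * U - 1` satisfies
-- `x* P x = 0` for all `x`.
theorem conjTranspose_mul_self {n : ℕ} (hstar : ∀ a : K, star a * a = algebraMap ℝ K (‖a‖ ^ 2))
    (U : Matrix (Fin n) (Fin n) K)
    (hU : ∀ x : Fin n → K, ‖WithLp.toLp 2 (U *ᵥ x)‖ = ‖WithLp.toLp 2 x‖) : Uᴴ * U = 1 := by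
  have hsq : ∀ x : Fin n → K, star x ⬝ᵥ x = algebraMap ℝ K (‖WithLp.toLp 2 x‖ ^ 2) := by
    intro x
    rw [PiLp.norm_sq_eq_of_L2, map_sum]
    exact Finset.sum_congr rfl fun i _ => hstar (x i)
  set P := Uᴴ * U - 1 with hP
  have hq : ∀ x : Fin n → K, star x ⬝ᵥ (P *ᵥ x) = 0 := by
    intro x
    have := hsq (U *ᵥ x)
    rw [hU, ← hsq, Matrix.star_mulVec, ← Matrix.dotProduct_mulVec, Matrix.mulVec_mulVec] at this
    rw [hP, Matrix.sub_mulVec, Matrix.one_mulVec, dotProduct_sub, this, sub_self]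
  have hherm : ∀ j k, P k j = star (P j k) := by
    intro j k
    have : Pᴴ = P := by simp [hP]
    exact (congrFun (congrFun this k) j).symm
  have hdiag : ∀ j, P j j = 0 := by
    intro j
    have := hq (Pi.single j 1)
    simpa [← Pi.single_star] using this
  have hzero : P = 0 := by
    ext j k
    -- With the entry `P k j` itself as coefficient, the two cross terms are both `‖P k j‖²` and
    -- cannot cancel.
    have := hq (Pi.single j 1 + Pi.single k (P k j))
    simp only [star_add, ← Pi.single_star, star_one, Matrix.mulVec_add, Matrix.mulVec_single,
      add_dotProduct, dotProduct_add, single_dotProduct, Pi.smul_apply, Matrix.col_apply,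
      MulOpposite.smul_eq_mul_unop, MulOpposite.unop_op, hdiag, one_mul, mul_one, zero_mul,
      mul_zero, zero_add, add_zero, ← hherm k j] at this
    have h2 : P j k * P k j = algebraMap ℝ K (‖P k j‖ ^ 2) := by rw [hherm k j, hstar]
    rw [h2, ← map_add] at this
    rw [hherm k j]
    rcases subsingleton_or_nontrivial K with hK | hK
    · exact Subsingleton.elim _ _
    have h3 := (map_eq_zero_iff _ (algebraMap ℝ K).injective).mp this
    have h4 : ‖P k j‖ = 0 := by nlinarith [norm_nonneg (P k j)]
    rw [norm_eq_zero.mp h4, star_zero]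
    rfl
  exact sub_eq_zero.mp hzero

omit hR in
/-- The isometries that commute with the action are the unitary matrices. -/
theorem commute_iff_isUnitaryIn {n : ℕ}
    (hstar : ∀ a : K, star a * a = algebraMap ℝ K (‖a‖ ^ 2))
    (e : h ≃ₗᵢ[ℝ] PiLp 2 (fun _ : Fin n => K)) (he : ∀ a w i, e (R a w) i = e w i * a)
    (S : h ≃ₗᵢ[ℝ] h) : (∀ a w, S (R a w) = R a (S w)) ↔ IsUnitaryIn e S := by
  constructor
  · have key : ∀ S : h ≃ₗᵢ[ℝ] h, (∀ a w, S (R a w) = R a (S w)) →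
        ∃ U : Matrix (Fin n) (Fin n) K, Uᴴ * U = 1 ∧
          ∀ z, e (S z) = WithLp.toLp 2 (U *ᵥ WithLp.ofLp (e z)) := by
      intro S hS
      let b : Fin n → h := fun j => e.symm (WithLp.toLp 2 (Pi.single j 1))
      have hb : ∀ z, z = ∑ j, R (e z j) (b j) := by
        intro z
        apply e.injective
        ext i
        rw [map_sum, WithLp.ofLp_sum, Finset.sum_apply, Finset.sum_eq_single i]
        · simp [he, b]
        · intro j _ hj
          simp [he, b, hj.symm]
        · simp
      have hU : ∀ z, e (S z) =
          WithLp.toLp 2 (Matrix.of (fun i j => e (S (b j)) i) *ᵥ WithLp.ofLp (e z)) := by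
        intro z
        conv_lhs => rw [hb z]
        ext i
        rw [map_sum, map_sum, WithLp.ofLp_sum, Finset.sum_apply]
        simp only [hS, he]
        rfl
      refine ⟨_, conjTranspose_mul_self hstar _ fun x => ?_, hU⟩
      have h1 := hU (e.symm (WithLp.toLp 2 x))
      rw [e.apply_symm_apply] at h1
      rw [← h1, e.norm_map, S.norm_map, e.symm.norm_map]
    intro hS
    obtain ⟨U, hU, hU'⟩ := key S hS
    -- The matrix of `S⁻¹` is a right inverse of `U`, hence equal to `Uᴴ`; this supplies `U * Uᴴ =
    -- 1`.
    obtain ⟨V, -, hV'⟩ := key S.symm fun a w => by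
      rw [LinearIsometryEquiv.symm_apply_eq, hS, S.apply_symm_apply]
    have hUV : U * V = 1 := by
      refine Matrix.ext_of_mulVec_single fun i => ?_
      have h1 := hU' (S.symm (e.symm (WithLp.toLp 2 (Pi.single i 1))))
      rw [hV', S.apply_symm_apply, e.apply_symm_apply] at h1
      rw [← Matrix.mulVec_mulVec, Matrix.one_mulVec]
      exact (congrArg WithLp.ofLp h1).symm
    have : Uᴴ = V := by rw [← mul_one Uᴴ, ← hUV, ← mul_assoc, hU, one_mul]
    refine ⟨U, Unitary.mem_iff.mpr ⟨hU, ?_⟩, hU'⟩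
    rw [Matrix.star_eq_conjTranspose, this, hUV]
  · rintro ⟨U, -, hU⟩ a w
    apply e.injective
    ext i
    rw [hU, he, hU]
    simp only [Matrix.mulVec, dotProduct, he, Finset.sum_mul, mul_assoc]

end IsRightAction

/-! ### Consequences of the `J²` condition. -/

namespace StratifiedAlgebra

variable {h v : Type*} [NormedAddCommGroup h] [InnerProductSpace ℝ h]
  [NormedAddCommGroup v] [InnerProductSpace ℝ v]
  [FiniteDimensional ℝ h] [FiniteDimensional ℝ v]

/-- The `J²` condition: `J σ J τ z` lies in `ℝ z + J v z`, stated on the orthogonal complement of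
this space, which is the orthogonal complement of `z` in the kernel of `[z, ·]`. -/
def JSquareCondition (G : StratifiedAlgebra h v) : Prop :=
  ∀ z w : h, ⟪z, w⟫ = 0 → G.bracket z w = 0 → ∀ σ, G.bracket z (G.J σ w) = 0

theorem IsIwasawaType.jSquareCondition {G : StratifiedAlgebra h v} (hI : G.IsIwasawaType) :
    G.JSquareCondition := by
  obtain ⟨hG, s, _, _, θ, A, φ, c, _, _, hθ, hA, hi, hr, hb, hc, hm⟩ := hI
  intro z w h1 h2 σ
  exact IsIwasawaEmbedding.bracket_J_eq_zero ⟨hθ, hA, hi, hr, hb, hc, hm⟩ hG h1 h2 σ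

/-- Every vector is the sum of an element of `ℝ z + J v z` and a vector orthogonal to `z` that
commutes with `z`. -/
theorem exists_add_J (G : StratifiedAlgebra h v) (z w : h) :
    ∃ (r : ℝ) (ρ : v) (q : h), w = r • z + G.J ρ z + q ∧ ⟪z, q⟫ = 0 ∧ G.bracket z q = 0 := by
  let f : ℝ × v →ₗ[ℝ] h :=
    { toFun := fun p => p.1 • z + G.J p.2 z
      map_add' := fun p p' => by simp only [Prod.fst_add, Prod.snd_add, J_add]; module
      map_smul' := fun r p => by
        simp only [Prod.smul_fst, Prod.smul_snd, J_smul, smul_eq_mul, RingHom.id_apply]; module }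
  obtain ⟨p, ⟨⟨r, ρ⟩, rfl⟩, q, hq, rfl⟩ := (LinearMap.range f).exists_add_mem_mem_orthogonal w
  refine ⟨r, ρ, q, rfl, ?_, ?_⟩
  · exact hq z ⟨(1, 0), by simp [f, J_zero]⟩
  · refine ext_inner_right ℝ fun τ => ?_
    rw [← inner_J, inner_zero_left]
    exact hq _ ⟨(0, τ), by simp [f]⟩

variable {G : StratifiedAlgebra h v} (hG : G.IsHeisenbergType) (hJ : G.JSquareCondition)
include hG hJ

/-- Decompose the vector as `r z + J ρ z + q`. The `J²` condition makes it orthogonal to `q`, so `q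
= 0`; orthogonality of `σ` and `τ` gives `r = 0`. -/
theorem exists_J_J_eq {σ τ : v} (hστ : ⟪σ, τ⟫ = 0) (z : h) :
    ∃ ρ, G.J σ (G.J τ z) = G.J ρ z := by
  rcases eq_or_ne z 0 with rfl | hz
  · exact ⟨0, by simp⟩
  obtain ⟨r, ρ, q, hw, hzq, hbq⟩ := G.exists_add_J z (G.J σ (G.J τ z))
  refine ⟨ρ, ?_⟩
  have hq : q = 0 := by
    have h1 : ⟪G.J σ (G.J τ z), q⟫ = 0 := by
      rw [← neg_eq_zero, ← inner_J_right, inner_J, hJ z q hzq hbq, inner_zero_left]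
    rw [hw, inner_add_left, inner_add_left, inner_smul_left, hzq, inner_J, hbq] at h1
    simpa using h1
  have hr : r = 0 := by
    have h1 : ⟪G.J σ (G.J τ z), z⟫ = 0 := by
      rw [← neg_eq_zero, ← inner_J_right, hG.inner_J_J, real_inner_comm, hστ, zero_mul]
    rw [hw, hq, inner_add_left, inner_add_left, inner_smul_left, inner_J_self] at h1
    simpa [hz] using h1
  rw [hw, hq, hr]
  simp

/-- The condition at `z + w` gives one `μ` serving both summands. Since `J v z` and `J v w` are
orthogonal, the two components can be compared separately. -/
theorem J_J_eq_of_bracket_eq_zero {σ τ ρ : v} (hστ : ⟪σ, τ⟫ = 0) {z w : h} (hz : z ≠ 0)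
    (hzw : ⟪z, w⟫ = 0) (hb : G.bracket z w = 0) (h1 : G.J σ (G.J τ z) = G.J ρ z) :
    G.J σ (G.J τ w) = G.J ρ w := by
  obtain ⟨μ, hμ⟩ := exists_J_J_eq hG hJ hστ (z + w)
  obtain ⟨κ, hκ⟩ := exists_J_J_eq hG hJ hστ w
  simp only [map_add, h1, hκ] at hμ
  have e : G.J (ρ - μ) z = G.J (μ - κ) w := by
    rw [sub_eq_add_neg, sub_eq_add_neg, J_add, J_add, J_neg, J_neg]
    linear_combination (norm := module) hμ
  have e0 : G.J (ρ - μ) z = 0 := by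
    rw [← inner_self_eq_zero (𝕜 := ℝ)]
    nth_rw 2 [e]
    rw [inner_J, hJ z w hzw hb, inner_zero_left]
  have e1 := hG.eq_zero_of_J_eq_zero hz e0
  rw [← sub_eq_zero.mp e1] at hμ
  rw [hκ]
  exact add_left_cancel hμ

/-- When `v` has dimension at least four, `h = ℝ z + J v z`. -/
theorem eq_zero_of_bracket_eq_zero {σ τ ρ μ : v} {z w : h} (hz : z ≠ 0) (hστ : ⟪σ, τ⟫ = 0)
    (h1 : G.J σ (G.J τ z) = G.J ρ z) (hρ : ρ ≠ 0) (hμ : μ ≠ 0) (hμσ : ⟪σ, μ⟫ = 0)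
    (hμτ : ⟪τ, μ⟫ = 0) (hμρ : ⟪ρ, μ⟫ = 0) (hzw : ⟪z, w⟫ = 0) (hb : G.bracket z w = 0) :
    w = 0 := by
  by_contra hw
  have h2 := J_J_eq_of_bracket_eq_zero hG hJ hστ hz hzw hb h1
  have h3 : G.J σ (G.J τ (G.J μ z)) = G.J ρ (G.J μ z) := by
    refine J_J_eq_of_bracket_eq_zero hG hJ hστ hw ?_ ?_ h2
    -- The relation passes from `z` to `w` and from `w` to `J μ z`. But `J μ` anticommutes with all
    -- three maps, which changes the sign of one side only.
    · rw [real_inner_comm, inner_J, hb, inner_zero_left]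
    · exact hJ w z (by rwa [real_inner_comm]) (by rw [bracket_swap, hb, neg_zero]) μ
  rw [hG.J_J_of_orthogonal hμτ, map_neg, hG.J_J_of_orthogonal hμσ, neg_neg, h1,
    hG.J_J_of_orthogonal hμρ] at h3
  have h4 : G.J μ (G.J ρ z) = 0 := by
    linear_combination (norm := module) (1 / 2 : ℝ) • h3
  refine hμ (hG.eq_zero_of_J_eq_zero (fun h5 => hρ (hG.eq_zero_of_J_eq_zero hz h5)) h4)

end StratifiedAlgebra

/-! ### Orthonormal families and quaternion coordinates. -/

theorem OrthonormalBasis.exists_of_forall_orthogonal {E : Type*} [NormedAddCommGroup E]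
    [InnerProductSpace ℝ E] [FiniteDimensional ℝ E] {n : ℕ} {b : Fin n → E} (hb : Orthonormal ℝ b)
    (h0 : ∀ x, (∀ i, ⟪b i, x⟫ = 0) → x = 0) : ∃ B : OrthonormalBasis (Fin n) ℝ E, ⇑B = b := by
  refine ⟨OrthonormalBasis.mkOfOrthogonalEqBot hb ?_, OrthonormalBasis.coe_of_orthogonal_eq_bot_mk _ _⟩
  rw [Submodule.eq_bot_iff]
  intro x hx
  exact h0 x fun i => hx _ (Submodule.subset_span ⟨i, rfl⟩)

/-- An orthonormal family is a basis or extends by one unit vector. -/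
theorem Orthonormal.exists_basis_or_extend {E : Type*} [NormedAddCommGroup E]
    [InnerProductSpace ℝ E] [FiniteDimensional ℝ E] {n : ℕ} {b : Fin n → E} (hb : Orthonormal ℝ b) :
    (∃ B : OrthonormalBasis (Fin n) ℝ E, ⇑B = b) ∨ ∃ x, ‖x‖ = 1 ∧ ∀ i, ⟪b i, x⟫ = 0 := by
  by_cases h0 : ∀ x, (∀ i, ⟪b i, x⟫ = 0) → x = 0
  · exact Or.inl (OrthonormalBasis.exists_of_forall_orthogonal hb h0)
  · push Not at h0
    obtain ⟨x, hx, hx0⟩ := h0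
    refine Or.inr ⟨‖x‖⁻¹ • x, ?_, fun i => by rw [inner_smul_right, hx, mul_zero]⟩
    rw [norm_smul, norm_inv, norm_norm, inv_mul_cancel₀ (norm_ne_zero_iff.mpr hx0)]

theorem Quaternion.norm_sq_eq (a : ℍ[ℝ]) :
    ‖a‖ ^ 2 = a.re ^ 2 + a.imI ^ 2 + a.imJ ^ 2 + a.imK ^ 2 := by
  rw [sq, ← Quaternion.normSq_eq_norm_mul_self, Quaternion.normSq_def']

theorem Quaternion.inner_eq (a b : ℍ[ℝ]) :
    ⟪a, b⟫ = a.re * b.re + a.imI * b.imI + a.imJ * b.imJ + a.imK * b.imK := by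
  simp [Quaternion.inner_def]

/-! ### The octonionic Heisenberg group. -/

namespace Octonion

theorem ext_iff' {x y : Octonion} : x = y ↔ x.fst = y.fst ∧ x.snd = y.snd :=
  ⟨by rintro rfl; exact ⟨rfl, rfl⟩, fun e => (WithLp.equiv 2 _).injective (Prod.ext e.1 e.2)⟩

theorem inner_eq (x y : Octonion) : ⟪x, y⟫ = ⟪x.fst, y.fst⟫ + ⟪x.snd, y.snd⟫ :=
  WithLp.prod_inner_apply ..

theorem norm_sq_eq (x : Octonion) : ‖x‖ ^ 2 = ‖x.fst‖ ^ 2 + ‖x.snd‖ ^ 2 := by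
  rw [← real_inner_self_eq_norm_sq, inner_eq, real_inner_self_eq_norm_sq,
    real_inner_self_eq_norm_sq]

theorem mem_imaginary {x : Octonion} : x ∈ imaginary ↔ x.fst.re = 0 := by
  change conj x = -x ↔ _
  rw [ext_iff']
  constructor
  · rintro ⟨h, -⟩
    have := congrArg QuaternionAlgebra.re h
    simp [conj] at this
    linarith
  · intro h
    refine ⟨?_, rfl⟩
    ext <;> simp [conj, h]

theorem re_imaginary (ω : imaginary) : (ω : Octonion).fst.re = 0 := mem_imaginary.mp ω.2

theorem inner_mul (ω : imaginary) (x y : Octonion) :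
    ⟪mul x ω, y⟫ = ⟪octonionicHeisenberg.bracket x y, ω⟫ := by
  have h0 := re_imaginary ω
  change _ = ⟪(1 / 2 : ℝ) • (mul (conj x) y - conj (mul (conj x) y)), (ω : Octonion)⟫
  rw [inner_eq, inner_eq]
  simp only [Quaternion.inner_eq]
  simp [mul, conj, h0]
  ring

theorem J_eq (ω : imaginary) (x : Octonion) : octonionicHeisenberg.J ω x = mul x ω := by
  refine ext_inner_right ℝ fun y => ?_
  rw [StratifiedAlgebra.inner_J, inner_mul]

theorem norm_mul (x y : Octonion) : ‖mul x y‖ = ‖x‖ * ‖y‖ := by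
  have : ‖mul x y‖ ^ 2 = (‖x‖ * ‖y‖) ^ 2 := by
    rw [mul_pow, norm_sq_eq, norm_sq_eq x, norm_sq_eq y]
    simp only [Quaternion.norm_sq_eq]
    simp [mul]
    ring
  exact (sq_eq_sq₀ (norm_nonneg _) (by positivity)).mp this

theorem isHeisenbergType : octonionicHeisenberg.IsHeisenbergType := by
  intro ω hω x
  have : ‖(ω : Octonion)‖ = 1 := hω
  rw [J_eq, norm_mul, this, mul_one]

theorem finrank_eq : Module.finrank ℝ Octonion = 8 := by
  rw [(WithLp.linearEquiv 2 ℝ (ℍ[ℝ] × ℍ[ℝ])).finrank_eq, Module.finrank_prod,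
    Quaternion.finrank_eq_four]

theorem finrank_imaginary : Module.finrank ℝ imaginary = 7 := by
  let f : Octonion →ₗ[ℝ] ℝ :=
    { toFun := fun x => x.fst.re
      map_add' := fun x y => by simp
      map_smul' := fun r x => by simp }
  have h1 := f.finrank_range_add_finrank_ker
  have h2 : LinearMap.range f = ⊤ := LinearMap.range_eq_top.mpr fun r =>
    ⟨WithLp.toLp 2 ((r : ℍ[ℝ]), 0), Quaternion.re_coe r⟩
  have h3 : LinearMap.ker f = imaginary := by
    ext x
    rw [mem_imaginary]
    rfl
  rw [h2, h3, finrank_eq, finrank_top, Module.finrank_self] at h1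
  omega

/-- A linear map that commutes with the multiplications from the right by imaginary octonions is
real. -/
theorem eq_smul_of_commute (S : Octonion →ₗ[ℝ] Octonion)
    (hS : ∀ x, ∀ ω ∈ imaginary, S (mul x ω) = mul (S x) ω) : ∃ r : ℝ, ∀ x, S x = r • x := by
  set a := S (WithLp.toLp 2 (1, 0)) with ha
  have one_mul : ∀ x, mul (WithLp.toLp 2 (1, 0)) x = x := fun x => by
    rw [ext_iff']; simp [mul]
  have h1 : ∀ ω ∈ imaginary, S ω = mul a ω := by
    intro ω hω
    rw [← hS _ ω hω, one_mul]
  have h2 : ∀ ω ∈ imaginary, ∀ η ∈ imaginary, mul ω η ∈ imaginary →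
      mul a (mul ω η) = mul (mul a ω) η := by
    intro ω hω η hη hωη
    rw [← h1 _ hωη, hS ω η hη, h1 ω hω]
  have e : ∀ p q : ℍ[ℝ], p.re = 0 → WithLp.toLp 2 (p, q) ∈ imaginary := fun p q hp =>
    mem_imaginary.mpr hp
  obtain ⟨i, i0, i1, i2, i3⟩ : ∃ i : ℍ[ℝ], i.re = 0 ∧ i.imI = 1 ∧ i.imJ = 0 ∧ i.imK = 0 :=
    ⟨⟨0, 1, 0, 0⟩, rfl, rfl, rfl, rfl⟩
  obtain ⟨j, j0, j1, j2, j3⟩ : ∃ j : ℍ[ℝ], j.re = 0 ∧ j.imI = 0 ∧ j.imJ = 1 ∧ j.imK = 0 :=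
    ⟨⟨0, 0, 1, 0⟩, rfl, rfl, rfl, rfl⟩
  -- By `h2`, `a = S 1` associates with the pairs `(i, j)`, `(i, ℓ)` and `(j, ℓ)`, where `ℓ = (0,
  -- 1)`. So it lies in the three quaternion subalgebras that they generate, whose intersection is
  -- `ℝ`.
  have c1 := h2 (WithLp.toLp 2 (i, 0)) (e _ _ i0) (WithLp.toLp 2 (j, 0)) (e _ _ j0)
    (by rw [mem_imaginary]; simp [mul, i0, i1, i2, i3, j0, j1, j2, j3])
  have c2 := h2 (WithLp.toLp 2 (i, 0)) (e _ _ i0) (WithLp.toLp 2 (0, 1)) (e _ _ rfl)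
    (by rw [mem_imaginary]; simp [mul])
  have c3 := h2 (WithLp.toLp 2 (j, 0)) (e _ _ j0) (WithLp.toLp 2 (0, 1)) (e _ _ rfl)
    (by rw [mem_imaginary]; simp [mul])
  simp only [ext_iff', mul, Quaternion.ext_iff] at c1 c2 c3
  simp [i0, i1, i2, i3, j0, j1, j2, j3] at c1 c2 c3
  obtain ⟨r, hr⟩ : ∃ r : ℝ, a = r • WithLp.toLp 2 (1, 0) := by
    refine ⟨a.fst.re, ?_⟩
    simp only [ext_iff', Quaternion.ext_iff]
    simp
    refine ⟨⟨?_, ?_, ?_⟩, ?_, ?_, ?_, ?_⟩ <;> linarith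
  refine ⟨r, fun x => ?_⟩
  obtain ⟨t, ω, hω, rfl⟩ : ∃ t : ℝ, ∃ ω ∈ imaginary, x = t • WithLp.toLp 2 (1, 0) + ω :=
    ⟨x.fst.re, x - x.fst.re • WithLp.toLp 2 (1, 0), by rw [mem_imaginary]; simp, by abel⟩
  rw [map_add, map_smul, ← ha, h1 ω hω, hr, smul_mul, one_mul]
  module

theorem commute_iff (S : Octonion ≃ₗᵢ[ℝ] Octonion) :
    S ∈ octonionicHeisenberg.invariantOrthogonalGroup ↔ S = 1 ∨ S = LinearIsometryEquiv.neg ℝ := by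
  constructor
  · intro hS
    obtain ⟨r, hr⟩ := eq_smul_of_commute S.toLinearEquiv.toLinearMap fun x ω hω => by
      have := hS ⟨ω, hω⟩ x
      rwa [J_eq, J_eq] at this
    replace hr : ∀ x, S x = r • x := hr
    have h1 : |r| = 1 := by
      obtain ⟨x, hx⟩ := exists_ne (0 : Octonion)
      have := S.norm_map x
      rw [hr, norm_smul, Real.norm_eq_abs] at this
      exact mul_right_cancel₀ (norm_ne_zero_iff.mpr hx) (by rw [this, _root_.one_mul])
    rcases eq_or_eq_neg_of_abs_eq h1 with rfl | rfl
    · left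
      ext1 x
      rw [hr, one_smul]
      rfl
    · right
      ext1 x
      rw [hr, neg_one_smul]
      rfl
  · rintro (rfl | rfl) ω z
    · rfl
    · exact (map_neg _ _).symm

theorem not_propertyH : ¬ octonionicHeisenberg.PropertyH := by
  intro hP
  have n1 : ‖(WithLp.toLp 2 (1, 0) : Octonion)‖ = 1 := by
    rw [← sq_eq_sq₀ (norm_nonneg _) zero_le_one, norm_sq_eq]
    simp
  have n2 : ‖(WithLp.toLp 2 (0, 1) : Octonion)‖ = 1 := by
    rw [← sq_eq_sq₀ (norm_nonneg _) zero_le_one, norm_sq_eq]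
    simp
  obtain ⟨S, hS, hS'⟩ := hP _ _ n1 n2
  rcases (commute_iff S).mp hS with rfl | rfl
  · exact zero_ne_one (congrArg WithLp.snd hS')
  · have : (-0 : ℍ[ℝ]) = 1 := congrArg WithLp.snd hS'
    simp at this

/-- Commuting with the generators means commuting with `J ω` for unit `ω`, hence by scaling for all
`ω`. The centralizer here is taken in `O(8)`; its elements have determinant one because the
dimension is even. -/
theorem mem_centralizer_spinSeven_iff (S : Octonion ≃ₗᵢ[ℝ] Octonion) :
    S ∈ Subgroup.centralizer (spinSeven : Set (Octonion ≃ₗᵢ[ℝ] Octonion)) ↔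
      S = 1 ∨ S = LinearIsometryEquiv.neg ℝ := by
  rw [spinSeven, Subgroup.centralizer_closure, Subgroup.mem_centralizer_iff]
  constructor
  · intro hS
    rw [← commute_iff]
    have hunit : ∀ ω : imaginary, ‖ω‖ = 1 → ∀ z,
        S (octonionicHeisenberg.J ω z) = octonionicHeisenberg.J ω (S z) := by
      intro ω hω z
      let T : Octonion ≃ₗᵢ[ℝ] Octonion := LinearIsometry.toLinearIsometryEquiv
        ⟨octonionicHeisenberg.J ω, isHeisenbergType ω hω⟩ rfl
      have := hS T ⟨ω, hω, fun z => rfl⟩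
      exact (congrArg (fun f : Octonion ≃ₗᵢ[ℝ] Octonion => f z) this).symm
    intro ω z
    rcases eq_or_ne ω 0 with rfl | hω
    · rw [StratifiedAlgebra.J_zero, StratifiedAlgebra.J_zero, map_zero]
    · have hn := norm_ne_zero_iff.mpr hω
      have := hunit (‖ω‖⁻¹ • ω) (by rw [norm_smul, norm_inv, norm_norm, inv_mul_cancel₀ hn]) z
      rw [StratifiedAlgebra.J_smul, StratifiedAlgebra.J_smul, map_smul] at this
      exact smul_right_injective _ (inv_ne_zero hn) this
  · rintro (rfl | rfl) T -
    · rw [_root_.mul_one, _root_.one_mul]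
    · ext1 z
      exact map_neg T z

theorem det_eq_one (S : Octonion ≃ₗᵢ[ℝ] Octonion) (hS : S = 1 ∨ S = LinearIsometryEquiv.neg ℝ) :
    LinearMap.det (S.toLinearEquiv : Octonion →ₗ[ℝ] Octonion) = 1 := by
  rcases hS with rfl | rfl
  · exact LinearMap.det_id
  · have : ((LinearIsometryEquiv.neg ℝ : Octonion ≃ₗᵢ[ℝ] Octonion).toLinearEquiv :
        Octonion →ₗ[ℝ] Octonion) = (-1 : ℝ) • LinearMap.id := by
      ext1 x
      simp
    rw [this, LinearMap.det_smul, finrank_eq, LinearMap.det_id]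
    norm_num

end Octonion

/-! ### Property (H) and `𝒮(h)` in the abelian, complex and quaternionic cases. -/

namespace StratifiedAlgebra

variable {h v : Type*} [NormedAddCommGroup h] [InnerProductSpace ℝ h]
  [NormedAddCommGroup v] [InnerProductSpace ℝ v]
  [FiniteDimensional ℝ h] [FiniteDimensional ℝ v] {G : StratifiedAlgebra h v}

/-- If the maps `J σ` and the scalars form an action of `K`, then `𝒮(h)` is the unitary group over
`K`. -/
theorem propertyH_and_unitary {K : Type*} [NormedRing K] [StarRing K] [NormedAlgebra ℝ K]
    [FiniteDimensional ℝ K] [Nontrivial K] [Nontrivial h]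
    (hstar : ∀ a : K, star a * a = algebraMap ℝ K (‖a‖ ^ 2))
    {R : K →ₗ[ℝ] h →ₗ[ℝ] h} (hR : IsRightAction R)
    (hJR : ∀ σ, ∃ a, ∀ z, G.J σ z = R a z)
    (hRJ : ∀ a, ∃ (r : ℝ) (σ : v), ∀ z, R a z = r • z + G.J σ z) :
    G.PropertyH ∧ ∃ n : ℕ, 0 < n ∧ ∃ e : h ≃ₗᵢ[ℝ] PiLp 2 (fun _ : Fin n => K),
      ∀ S : h ≃ₗᵢ[ℝ] h, S ∈ G.invariantOrthogonalGroup ↔ IsUnitaryIn e S := by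
  have hmem : ∀ S : h ≃ₗᵢ[ℝ] h, S ∈ G.invariantOrthogonalGroup ↔
      ∀ a w, S (R a w) = R a (S w) := by
    intro S
    constructor
    · intro hS a w
      obtain ⟨r, σ, e⟩ := hRJ a
      rw [e, e, map_add, map_smul, hS σ w]
    · intro hS σ w
      obtain ⟨a, e⟩ := hJR σ
      rw [e, e, hS]
  refine ⟨fun z w hz hw => ?_, ?_⟩
  · obtain ⟨S, hS, hS'⟩ := hR.exists_commuting_isometry hz hw
    exact ⟨S, (hmem S).mpr hS, hS'⟩
  · obtain ⟨z, hz⟩ := exists_norm_eq h (zero_le_one (α := ℝ))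
    obtain ⟨n, e, -, he⟩ := hR.exists_coordinates hz
    exact ⟨n + 1, n.succ_pos, e, fun S =>
      (hmem S).trans (IsRightAction.commute_iff_isUnitaryIn hstar e he S)⟩

theorem J_eq_sum {ι : Type*} [Fintype ι] (B : OrthonormalBasis ι ℝ v) (σ : v) (z : h) :
    G.J σ z = ∑ i, B.repr σ i • G.J (B i) z := by
  conv_lhs => rw [← B.sum_repr σ]
  have h0 : ∀ τ, G.J τ z = (AddMonoidHom.mk' (fun τ => G.J τ z) fun a b => G.J_add a b z) τ :=
    fun τ => rfl
  rw [h0, map_sum]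
  exact Finset.sum_congr rfl fun i _ => G.J_smul _ _ z

theorem propertyH_of_subsingleton [Subsingleton v] : G.PropertyH := by
  intro z w hz hw
  refine ⟨(ℝ ∙ (z - w))ᗮ.reflection, fun σ u => ?_, Submodule.reflection_sub (hz.trans hw.symm)⟩
  rw [Subsingleton.elim σ 0, J_zero, J_zero, map_zero]

variable (hG : G.IsHeisenbergType)
include hG

theorem IsHeisenbergType.norm_smul_add_J_sq (r : ℝ) (σ : v) (z : h) :
    ‖r • z + G.J σ z‖ ^ 2 = (r ^ 2 + ‖σ‖ ^ 2) * ‖z‖ ^ 2 := by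
  rw [norm_add_sq_real, inner_smul_left, real_inner_comm, inner_J_self, hG.norm_J, norm_smul,
    mul_pow, mul_pow, Real.norm_eq_abs, sq_abs]
  ring

theorem propertyH_and_unitary_complex (B : OrthonormalBasis (Fin 1) ℝ v) :
    G.PropertyH ∧ ∃ n : ℕ, 0 < n ∧ ∃ e : h ≃ₗᵢ[ℝ] PiLp 2 (fun _ : Fin n => ℂ),
      ∀ S : h ≃ₗᵢ[ℝ] h, S ∈ G.invariantOrthogonalGroup ↔ IsUnitaryIn e S := by
  have hn : ‖B 0‖ = 1 := B.orthonormal.1 0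
  have : Nontrivial v := ⟨B 0, 0, by rw [← norm_ne_zero_iff, hn]; exact one_ne_zero⟩
  have : Nontrivial h := G.nontrivial_of_nontrivial
  let R : ℂ →ₗ[ℝ] h →ₗ[ℝ] h :=
    { toFun := fun a => a.re • LinearMap.id + a.im • G.J (B 0)
      map_add' := fun a b => by simp only [Complex.add_re, Complex.add_im]; module
      map_smul' := fun r a => by
        simp only [Complex.smul_re, Complex.smul_im, smul_eq_mul, RingHom.id_apply]; module }
  have hRa : ∀ a z, R a z = a.re • z + a.im • G.J (B 0) z := fun a z => rfl
  have hsq : ∀ z, G.J (B 0) (G.J (B 0) z) = -z := fun z => by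
    rw [hG.J_J_self, hn]; simp
  refine propertyH_and_unitary (R := R) ?_ ⟨?_, ?_, ?_, ?_⟩ ?_ ?_
  · intro a
    have : star a * a = (Complex.normSq a : ℂ) := (Complex.normSq_eq_conj_mul_self).symm
    rw [this, Complex.normSq_eq_norm_sq]
    rfl
  · intro z
    simp [hRa]
  · intro a b z
    simp only [hRa, Complex.mul_re, Complex.mul_im, map_add, map_smul, hsq]
    module
  · intro a z
    rw [← sq_eq_sq₀ (norm_nonneg _) (by positivity), hRa, ← J_smul, hG.norm_smul_add_J_sq,
      norm_smul, hn, mul_one, mul_pow, ← Complex.normSq_eq_norm_sq, Complex.normSq_apply,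
      Real.norm_eq_abs, sq_abs]
    ring
  · intro a z w
    simp only [hRa, inner_add_left, inner_add_right, inner_smul_left, inner_smul_right,
      inner_J_right]
    simp
  · intro σ
    refine ⟨⟨0, B.repr σ 0⟩, fun z => ?_⟩
    rw [J_eq_sum B, hRa]
    simp
  · intro a
    exact ⟨a.re, a.im • B 0, fun z => by rw [hRa, J_smul]⟩

theorem propertyH_and_unitary_quaternion (B : OrthonormalBasis (Fin 3) ℝ v)
    (h21 : ∀ z, G.J (B 1) (G.J (B 0) z) = G.J (B 2) z) :
    G.PropertyH ∧ ∃ n : ℕ, 0 < n ∧ ∃ e : h ≃ₗᵢ[ℝ] PiLp 2 (fun _ : Fin n => ℍ[ℝ]),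
      ∀ S : h ≃ₗᵢ[ℝ] h, S ∈ G.invariantOrthogonalGroup ↔ IsUnitaryIn e S := by
  have hn : ∀ i, ‖B i‖ = 1 := B.orthonormal.1
  have : Nontrivial v := ⟨B 0, 0, by rw [← norm_ne_zero_iff, hn]; exact one_ne_zero⟩
  have : Nontrivial h := G.nontrivial_of_nontrivial
  -- The units `i, j, k` act by `J (B 0)`, `J (B 1)`, `J (B 2)`. In a right action `R (i * j)`
  -- applies `R i` first, which explains the order of the factors in `h21`.
  let R : ℍ[ℝ] →ₗ[ℝ] h →ₗ[ℝ] h :=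
    { toFun := fun a => a.re • LinearMap.id + a.imI • G.J (B 0) + a.imJ • G.J (B 1) +
        a.imK • G.J (B 2)
      map_add' := fun a b => by
        simp only [Quaternion.re_add, Quaternion.imI_add, Quaternion.imJ_add, Quaternion.imK_add]
        module
      map_smul' := fun r a => by
        simp only [Quaternion.re_smul, Quaternion.imI_smul, Quaternion.imJ_smul,
          Quaternion.imK_smul, smul_eq_mul, RingHom.id_apply]
        module }
  have hRa : ∀ a z, R a z = a.re • z + a.imI • G.J (B 0) z + a.imJ • G.J (B 1) z +
      a.imK • G.J (B 2) z := fun a z => rfl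
  have hRa' : ∀ a z, R a z =
      a.re • z + G.J (B.repr.symm (WithLp.toLp 2 ![a.imI, a.imJ, a.imK])) z := by
    intro a z
    rw [J_eq_sum B, hRa]
    simp [Fin.sum_univ_three]
    module
  have hsq : ∀ i z, G.J (B i) (G.J (B i) z) = -z := fun i z => by
    rw [hG.J_J_self, hn]; simp
  have hanti : ∀ i j, i ≠ j → ∀ z, G.J (B i) (G.J (B j) z) = -G.J (B j) (G.J (B i) z) :=
    fun i j hij z => hG.J_J_of_orthogonal (B.orthonormal.2 hij) z
  have h12 : ∀ z, G.J (B 0) (G.J (B 1) z) = -G.J (B 2) z := fun z => by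
    rw [hanti 0 1 (by decide), h21]
  have h31 : ∀ z, G.J (B 2) (G.J (B 0) z) = -G.J (B 1) z := fun z => by
    rw [← h21, hsq, map_neg]
  have h13 : ∀ z, G.J (B 0) (G.J (B 2) z) = G.J (B 1) z := fun z => by
    rw [hanti 0 2 (by decide), h31, neg_neg]
  have h23 : ∀ z, G.J (B 1) (G.J (B 2) z) = -G.J (B 0) z := fun z => by
    rw [← h21, hsq]
  have h32 : ∀ z, G.J (B 2) (G.J (B 1) z) = G.J (B 0) z := fun z => by
    rw [hanti 2 1 (by decide), h23, neg_neg]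
  refine propertyH_and_unitary (R := R) ?_ ⟨?_, ?_, ?_, ?_⟩ ?_ ?_
  · intro a
    rw [Quaternion.star_mul_self, Quaternion.normSq_eq_norm_mul_self, ← sq]
    rfl
  · intro z
    simp [hRa]
  · intro a b z
    simp only [hRa, Quaternion.re_mul, Quaternion.imI_mul, Quaternion.imJ_mul, Quaternion.imK_mul,
      map_add, map_smul, hsq, h21, h12, h31, h13, h23, h32]
    module
  · intro a z
    rw [← sq_eq_sq₀ (norm_nonneg _) (by positivity), hRa', hG.norm_smul_add_J_sq,
      LinearIsometryEquiv.norm_map, mul_pow, Quaternion.norm_sq_eq, EuclideanSpace.norm_sq_eq]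
    simp [Fin.sum_univ_three]
    left
    ring
  · intro a z w
    simp only [hRa, inner_add_left, inner_add_right, inner_smul_left, inner_smul_right,
      inner_J_right]
    simp
  · intro σ
    obtain ⟨a, a0, a1, a2, a3⟩ : ∃ a : ℍ[ℝ], a.re = 0 ∧ a.imI = B.repr σ 0 ∧
        a.imJ = B.repr σ 1 ∧ a.imK = B.repr σ 2 :=
      ⟨⟨0, B.repr σ 0, B.repr σ 1, B.repr σ 2⟩, rfl, rfl, rfl, rfl⟩
    refine ⟨a, fun z => ?_⟩
    rw [J_eq_sum B, hRa, a0, a1, a2, a3, Fin.sum_univ_three, zero_smul, zero_add]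
  · intro a
    exact ⟨a.re, _, hRa' a⟩

end StratifiedAlgebra

/-! ### Octonionic frames and the isometry with the octonionic group. -/

namespace StratifiedAlgebra

variable {h v : Type*} [NormedAddCommGroup h] [InnerProductSpace ℝ h]
  [NormedAddCommGroup v] [InnerProductSpace ℝ v]
  [FiniteDimensional ℝ h] [FiniteDimensional ℝ v] {G : StratifiedAlgebra h v}

/-- At the unit vector `z`, the maps `J (s i)` for the orthonormal family `s` compose like the right
multiplications of the octonions by seven imaginary units at the octonion `1`. -/
structure IsOctonionicAt (G : StratifiedAlgebra h v) (z : h) (s : Fin 7 → v) : Prop where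
  norm_eq : ‖z‖ = 1
  orthonormal : Orthonormal ℝ s
  J_one_zero : G.J (s 1) (G.J (s 0) z) = G.J (s 2) z
  J_zero_three : G.J (s 0) (G.J (s 3) z) = G.J (s 4) z
  J_one_three : G.J (s 1) (G.J (s 3) z) = G.J (s 5) z
  J_two_three : G.J (s 2) (G.J (s 3) z) = G.J (s 6) z

/-- The linear map from the octonions to `v` with the given values on the imaginary units. -/
noncomputable def fromOctonion (s : Fin 7 → v) : Octonion →ₗ[ℝ] v where
  toFun x := x.fst.imI • s 0 + x.fst.imJ • s 1 + x.fst.imK • s 2 + x.snd.re • s 3 +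
    x.snd.imI • s 4 + x.snd.imJ • s 5 + x.snd.imK • s 6
  map_add' x y := by
    simp only [WithLp.add_fst, WithLp.add_snd, Quaternion.re_add, Quaternion.imI_add,
      Quaternion.imJ_add, Quaternion.imK_add]
    module
  map_smul' r x := by
    simp only [WithLp.smul_fst, WithLp.smul_snd, Quaternion.re_smul, Quaternion.imI_smul,
      Quaternion.imJ_smul, Quaternion.imK_smul, RingHom.id_apply, smul_eq_mul]
    module

omit [FiniteDimensional ℝ v] in
theorem fromOctonion_apply (s : Fin 7 → v) (x : Octonion) :
    fromOctonion s x = x.fst.imI • s 0 + x.fst.imJ • s 1 + x.fst.imK • s 2 + x.snd.re • s 3 +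
    x.snd.imI • s 4 + x.snd.imJ • s 5 + x.snd.imK • s 6 := rfl

omit [FiniteDimensional ℝ v] in
theorem norm_fromOctonion_sq (B : OrthonormalBasis (Fin 7) ℝ v) (x : Octonion) :
    ‖fromOctonion B x‖ ^ 2 = ‖x‖ ^ 2 - x.fst.re ^ 2 := by
  have : fromOctonion B x = B.repr.symm (WithLp.toLp 2 ![x.fst.imI, x.fst.imJ, x.fst.imK,
      x.snd.re, x.snd.imI, x.snd.imJ, x.snd.imK]) := by
    rw [← B.sum_repr_symm, Fin.sum_univ_seven]
    rfl
  rw [this, LinearIsometryEquiv.norm_map, EuclideanSpace.norm_sq_eq, Octonion.norm_sq_eq,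
    Quaternion.norm_sq_eq, Quaternion.norm_sq_eq, Fin.sum_univ_seven]
  simp only [Real.norm_eq_abs, sq_abs]
  simp
  ring

omit [FiniteDimensional ℝ v] in
theorem exists_fromOctonion_eq (B : OrthonormalBasis (Fin 7) ℝ v) (r : ℝ) (σ : v) :
    ∃ x : Octonion, x.fst.re = r ∧ fromOctonion B x = σ := by
  refine ⟨WithLp.toLp 2 (⟨r, B.repr σ 0, B.repr σ 1, B.repr σ 2⟩,
    ⟨B.repr σ 3, B.repr σ 4, B.repr σ 5, B.repr σ 6⟩), rfl, ?_⟩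
  conv_rhs => rw [← B.sum_repr σ, Fin.sum_univ_seven]
  rfl

variable (hG : G.IsHeisenbergType)
include hG

/-- The map from the octonions to `h` determined by a frame intertwines the maps `J`. -/
theorem IsOctonionicAt.map_mul {z : h} {s : Fin 7 → v} (hz : IsOctonionicAt G z s)
    (ω x : Octonion) (hω : ω.fst.re = 0) :
    (x.mul ω).fst.re • z + G.J (fromOctonion s (x.mul ω)) z =
      G.J (fromOctonion s ω) (x.fst.re • z + G.J (fromOctonion s x) z) := by
  have sq : ∀ i u, G.J (s i) (G.J (s i) u) = -u := fun i u => by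
    rw [hG.J_J_self, hz.orthonormal.1]; simp
  have anti : ∀ i j, i ≠ j → ∀ u, G.J (s i) (G.J (s j) u) = -G.J (s j) (G.J (s i) u) :=
    fun i j hij u => hG.J_J_of_orthogonal (hz.orthonormal.2 hij) u
  have h10 := hz.J_one_zero
  have h03 := hz.J_zero_three
  have h13 := hz.J_one_three
  have h23 := hz.J_two_three
  -- The digits in `hij` name the product `J (s i) (J (s j) z)`. The four given relations,
  -- anticommutation and `J (s i)² = -1` produce the whole multiplication table.
  have h01 : G.J (s 0) (G.J (s 1) z) = -G.J (s 2) z := by rw [anti 0 1 (by decide), h10]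
  have h02 : G.J (s 0) (G.J (s 2) z) = G.J (s 1) z := by
    rw [← h10, anti 0 1 (by decide), sq, map_neg, neg_neg]
  have h12 : G.J (s 1) (G.J (s 2) z) = -G.J (s 0) z := by rw [← h10, sq]
  have h20 : G.J (s 2) (G.J (s 0) z) = -G.J (s 1) z := by rw [anti 2 0 (by decide), h02]
  have h21 : G.J (s 2) (G.J (s 1) z) = G.J (s 0) z := by rw [anti 2 1 (by decide), h12, neg_neg]
  have h30 : G.J (s 3) (G.J (s 0) z) = -G.J (s 4) z := by rw [anti 3 0 (by decide), h03]
  have h31 : G.J (s 3) (G.J (s 1) z) = -G.J (s 5) z := by rw [anti 3 1 (by decide), h13]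
  have h32 : G.J (s 3) (G.J (s 2) z) = -G.J (s 6) z := by rw [anti 3 2 (by decide), h23]
  have h04 : G.J (s 0) (G.J (s 4) z) = -G.J (s 3) z := by rw [← h03, sq]
  have h15 : G.J (s 1) (G.J (s 5) z) = -G.J (s 3) z := by rw [← h13, sq]
  have h26 : G.J (s 2) (G.J (s 6) z) = -G.J (s 3) z := by rw [← h23, sq]
  have h34 : G.J (s 3) (G.J (s 4) z) = G.J (s 0) z := by
    rw [← h03, anti 3 0 (by decide), sq, map_neg, neg_neg]
  have h35 : G.J (s 3) (G.J (s 5) z) = G.J (s 1) z := by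
    rw [← h13, anti 3 1 (by decide), sq, map_neg, neg_neg]
  have h36 : G.J (s 3) (G.J (s 6) z) = G.J (s 2) z := by
    rw [← h23, anti 3 2 (by decide), sq, map_neg, neg_neg]
  have h05 : G.J (s 0) (G.J (s 5) z) = G.J (s 6) z := by
    rw [← h13, anti 1 3 (by decide), map_neg, anti 0 3 (by decide), h01, map_neg, h32]; abel
  have h14 : G.J (s 1) (G.J (s 4) z) = -G.J (s 6) z := by
    rw [← h03, anti 0 3 (by decide), map_neg, anti 1 3 (by decide), h10, h32]; abel
  have h06 : G.J (s 0) (G.J (s 6) z) = -G.J (s 5) z := by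
    rw [← h23, anti 2 3 (by decide), map_neg, anti 0 3 (by decide), h02, h31]; abel
  have h24 : G.J (s 2) (G.J (s 4) z) = G.J (s 5) z := by
    rw [← h03, anti 0 3 (by decide), map_neg, anti 2 3 (by decide), h20, map_neg, h31]; abel
  have h16 : G.J (s 1) (G.J (s 6) z) = G.J (s 4) z := by
    rw [← h23, anti 2 3 (by decide), map_neg, anti 1 3 (by decide), h12, map_neg, h30]; abel
  have h25 : G.J (s 2) (G.J (s 5) z) = -G.J (s 4) z := by
    rw [← h13, anti 1 3 (by decide), map_neg, anti 2 3 (by decide), h21, h30]; abel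
  have h40 : G.J (s 4) (G.J (s 0) z) = G.J (s 3) z := by rw [anti 4 0 (by decide), h04, neg_neg]
  have h51 : G.J (s 5) (G.J (s 1) z) = G.J (s 3) z := by rw [anti 5 1 (by decide), h15, neg_neg]
  have h62 : G.J (s 6) (G.J (s 2) z) = G.J (s 3) z := by rw [anti 6 2 (by decide), h26, neg_neg]
  have h43 : G.J (s 4) (G.J (s 3) z) = -G.J (s 0) z := by rw [anti 4 3 (by decide), h34]
  have h53 : G.J (s 5) (G.J (s 3) z) = -G.J (s 1) z := by rw [anti 5 3 (by decide), h35]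
  have h63 : G.J (s 6) (G.J (s 3) z) = -G.J (s 2) z := by rw [anti 6 3 (by decide), h36]
  have h50 : G.J (s 5) (G.J (s 0) z) = -G.J (s 6) z := by rw [anti 5 0 (by decide), h05]
  have h41 : G.J (s 4) (G.J (s 1) z) = G.J (s 6) z := by rw [anti 4 1 (by decide), h14, neg_neg]
  have h60 : G.J (s 6) (G.J (s 0) z) = G.J (s 5) z := by rw [anti 6 0 (by decide), h06, neg_neg]
  have h42 : G.J (s 4) (G.J (s 2) z) = -G.J (s 5) z := by rw [anti 4 2 (by decide), h24]
  have h61 : G.J (s 6) (G.J (s 1) z) = -G.J (s 4) z := by rw [anti 6 1 (by decide), h16]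
  have h52 : G.J (s 5) (G.J (s 2) z) = G.J (s 4) z := by rw [anti 5 2 (by decide), h25, neg_neg]
  have h45 : G.J (s 4) (G.J (s 5) z) = G.J (s 2) z := by
    rw [← h13, anti 1 3 (by decide), map_neg, anti 4 3 (by decide), h41, h36]; abel
  have h46 : G.J (s 4) (G.J (s 6) z) = -G.J (s 1) z := by
    rw [← h23, anti 2 3 (by decide), map_neg, anti 4 3 (by decide), h42, map_neg, h35]; abel
  have h56 : G.J (s 5) (G.J (s 6) z) = G.J (s 0) z := by
    rw [← h23, anti 2 3 (by decide), map_neg, anti 5 3 (by decide), h52, h34]; abel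
  have h54 : G.J (s 5) (G.J (s 4) z) = -G.J (s 2) z := by rw [anti 5 4 (by decide), h45]
  have h64 : G.J (s 6) (G.J (s 4) z) = G.J (s 1) z := by rw [anti 6 4 (by decide), h46, neg_neg]
  have h65 : G.J (s 6) (G.J (s 5) z) = -G.J (s 0) z := by rw [anti 6 5 (by decide), h56]
  simp only [fromOctonion_apply, Octonion.mul, WithLp.toLp_fst, WithLp.toLp_snd, Quaternion.re_sub,
    Quaternion.imI_sub, Quaternion.imJ_sub, Quaternion.imK_sub, Quaternion.re_add,
    Quaternion.imI_add, Quaternion.imJ_add, Quaternion.imK_add, Quaternion.re_mul,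
    Quaternion.imI_mul, Quaternion.imJ_mul, Quaternion.imK_mul, Quaternion.re_star,
    Quaternion.imI_star, Quaternion.imJ_star, Quaternion.imK_star, hω, J_add, J_smul, map_add,
    map_smul, sq, h01, h02, h03, h04, h05, h06, h10, h12, h13, h14, h15, h16, h20, h21, h23, h24,
    h25, h26, h30, h31, h32, h34, h35, h36, h40, h41, h42, h43, h45, h46, h50, h51, h52, h53, h54,
    h56, h60, h61, h62, h63, h64, h65]
  module

/-- The octonion `1` corresponds to `z` and an imaginary `ω` to `J ω z`; `hspan` gives surjectivity.
The bracket is dual to `J`, so it suffices that the maps `J` are intertwined. -/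
theorem isIsometricTo_octonionicHeisenberg {z : h} {B : OrthonormalBasis (Fin 7) ℝ v}
    (hz : IsOctonionicAt G z B) (hspan : ∀ w, ⟪z, w⟫ = 0 → G.bracket z w = 0 → w = 0) :
    G.IsIsometricTo octonionicHeisenberg := by
  let E : Octonion →ₗ[ℝ] h :=
    { toFun := fun x => x.fst.re • z + G.J (fromOctonion B x) z
      map_add' := fun x y => by
        rw [map_add, J_add, WithLp.add_fst, Quaternion.re_add]; module
      map_smul' := fun r x => by
        rw [map_smul, J_smul, WithLp.smul_fst, Quaternion.re_smul, smul_eq_mul, RingHom.id_apply]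
        module }
  have hE : ∀ x, E x = x.fst.re • z + G.J (fromOctonion B x) z := fun x => rfl
  let e : Octonion ≃ₗᵢ[ℝ] h := LinearIsometryEquiv.ofSurjective ⟨E, fun x => by
    rw [← sq_eq_sq₀ (norm_nonneg _) (norm_nonneg _), hE, hG.norm_smul_add_J_sq,
      norm_fromOctonion_sq, hz.norm_eq]
    ring⟩ fun w => by
      obtain ⟨r, ρ, q, hw, h1, h2⟩ := G.exists_add_J z w
      obtain ⟨x, hx, hx'⟩ := exists_fromOctonion_eq B r ρ
      refine ⟨x, ?_⟩
      change E x = w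
      rw [hE, hx, hx', hw, hspan q h1 h2, add_zero]
  let f : Octonion.imaginary ≃ₗᵢ[ℝ] v := LinearIsometryEquiv.ofSurjective
    ⟨fromOctonion B ∘ₗ Octonion.imaginary.subtype, fun x => by
      rw [← sq_eq_sq₀ (norm_nonneg _) (norm_nonneg _), LinearMap.comp_apply, norm_fromOctonion_sq,
        Submodule.subtype_apply, Octonion.re_imaginary]
      simp⟩ fun σ => by
      obtain ⟨x, hx, hx'⟩ := exists_fromOctonion_eq B 0 σ
      exact ⟨⟨x, Octonion.mem_imaginary.mpr hx⟩, hx'⟩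
  have key : ∀ x y, G.bracket (e x) (e y) = f (octonionicHeisenberg.bracket x y) := by
    intro x y
    refine ext_inner_right ℝ fun σ => ?_
    obtain ⟨ω, rfl⟩ := f.surjective σ
    have h1 : G.J (f ω) (e x) = e (x.mul ω) := (hz.map_mul hG ω x (Octonion.re_imaginary ω)).symm
    rw [f.inner_map_map, ← inner_J, ← inner_J, h1, e.inner_map_map, Octonion.J_eq]
  refine ⟨e.symm, f.symm, fun w w' => ?_⟩
  rw [f.symm_apply_eq, ← key, e.apply_symm_apply, e.apply_symm_apply]

end StratifiedAlgebra

/-! ### Classification by the dimension of `v`. -/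

namespace StratifiedAlgebra

variable {h v : Type*} [NormedAddCommGroup h] [InnerProductSpace ℝ h]
  [NormedAddCommGroup v] [InnerProductSpace ℝ v]
  [FiniteDimensional ℝ h] [FiniteDimensional ℝ v] {G : StratifiedAlgebra h v}
  (hG : G.IsHeisenbergType) (hJ : G.JSquareCondition)

include hG in
theorem IsHeisenbergType.inner_eq_of_norm_eq_one {z : h} (hz : ‖z‖ = 1) (σ τ : v) :
    ⟪σ, τ⟫ = ⟪G.J σ z, G.J τ z⟫ := by
  rw [hG.inner_J_J, hz]; ring

include hG hJ

/-- This is Cayley-Dickson doubling at `z`: `x` is the new unit and `t i`, with `J (b i) (J x z) = J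
(t i) z`, are its products with the old ones. The process stops at seven because one more unit `y`
would make `J (b 1) J (b 0) J x J y z` equal to its own negative. -/
theorem exists_octonionicAt {z : h} (hz : ‖z‖ = 1) {b : Fin 3 → v} (hb : Orthonormal ℝ b)
    (h10 : G.J (b 1) (G.J (b 0) z) = G.J (b 2) z) {x : v} (hx : ‖x‖ = 1)
    (hbx : ∀ i, ⟪b i, x⟫ = 0) : ∃ B : OrthonormalBasis (Fin 7) ℝ v, IsOctonionicAt G z B := by
  have hz0 : z ≠ 0 := by rw [← norm_ne_zero_iff, hz]; exact one_ne_zero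
  have hip := hG.inner_eq_of_norm_eq_one hz
  choose t ht using fun i => exists_J_J_eq hG hJ (hbx i) z
  have sq : ∀ i u, G.J (b i) (G.J (b i) u) = -u := fun i u => by
    rw [hG.J_J_self, hb.1]; simp
  have anti : ∀ i j, i ≠ j → ∀ u, G.J (b i) (G.J (b j) u) = -G.J (b j) (G.J (b i) u) :=
    fun i j hij u => hG.J_J_of_orthogonal (hb.2 hij) u
  have h01 : G.J (b 0) (G.J (b 1) z) = -G.J (b 2) z := by rw [anti 0 1 (by decide), h10]
  have h02 : G.J (b 0) (G.J (b 2) z) = G.J (b 1) z := by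
    rw [← h10, anti 0 1 (by decide), sq, map_neg, neg_neg]
  have h12 : G.J (b 1) (G.J (b 2) z) = -G.J (b 0) z := by rw [← h10, sq]
  have h20 : G.J (b 2) (G.J (b 0) z) = -G.J (b 1) z := by rw [anti 2 0 (by decide), h02]
  have h21 : G.J (b 2) (G.J (b 1) z) = G.J (b 0) z := by rw [anti 2 1 (by decide), h12, neg_neg]
  have horth : ∀ y, (∀ i, ⟪b i, y⟫ = 0) → ∀ i j, ⟪G.J (b i) (G.J (b j) z), G.J y z⟫ = 0 := by
    intro y hy i j
    have h0 : ∀ k, ⟪G.J (b k) z, G.J y z⟫ = 0 := fun k => by rw [← hip, hy]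
    have h1 : ⟪z, G.J y z⟫ = 0 := by rw [real_inner_comm, inner_J_self]
    fin_cases i <;> fin_cases j <;> simp [sq, h10, h01, h02, h12, h20, h21, h0, h1]
  have hbt : ∀ i j, ⟪b i, t j⟫ = 0 := by
    intro i j
    rw [hip, ← ht, inner_J_right, horth x hbx, neg_zero]
  have hxt : ∀ j, ⟪x, t j⟫ = 0 := by
    intro j
    rw [hip, ← ht, real_inner_comm, inner_J_self]
  have hxz : ‖G.J x z‖ = 1 := by rw [hG.norm_J, hx, hz, one_mul]
  have htt : ∀ i j, ⟪t i, t j⟫ = ⟪b i, b j⟫ := by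
    intro i j
    rw [hip, ← ht, ← ht, hG.inner_J_J, hxz]; ring
  have hbb : ∀ i j, i ≠ j → ⟪b i, b j⟫ = 0 := fun i j hij => hb.2 hij
  have hs : Orthonormal ℝ ![b 0, b 1, b 2, x, t 0, t 1, t 2] := by
    have htn : ∀ i, ‖t i‖ = 1 := fun i => by
      rw [← sq_eq_sq₀ (norm_nonneg _) zero_le_one, ← real_inner_self_eq_norm_sq, htt,
        real_inner_self_eq_norm_sq, hb.1]
    refine ⟨fun i => ?_, fun i j hij => ?_⟩
    · fin_cases i <;> simp [hb.1, hx, htn]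
    · fin_cases i <;> fin_cases j <;>
        first
        | exact absurd rfl hij
        | exact hbb _ _ (by decide)
        | exact hbx _
        | exact hbt _ _
        | exact hxt _
        | exact (htt _ _).trans (hbb _ _ (by decide))
        | exact (real_inner_comm _ _).trans (hbx _)
        | exact (real_inner_comm _ _).trans (hbt _ _)
        | exact (real_inner_comm _ _).trans (hxt _)
  obtain ⟨B, hB⟩ := OrthonormalBasis.exists_of_forall_orthogonal hs fun y hy => by
    have hby : ∀ i, ⟪b i, y⟫ = 0 := fun i => by
      fin_cases i
      exacts [hy 0, hy 1, hy 2]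
    have hxy : ⟪x, y⟫ = 0 := hy 3
    have hty : ∀ i, ⟪t i, y⟫ = 0 := fun i => by
      fin_cases i
      exacts [hy 4, hy 5, hy 6]
    obtain ⟨ρ, hρ⟩ := exists_J_J_eq hG hJ hxy z
    have hbρ : ∀ i, ⟪b i, ρ⟫ = 0 := by
      intro i
      rw [hip, ← hρ, inner_J_right, hG.J_J_of_orthogonal ((real_inner_comm _ _).trans (hbx i)), ht,
        inner_neg_left, ← hip, hty]
      simp
    -- With `J ρ z = J x (J y z)`, moving `J (b 1) J (b 0)` inside to `z` and `J (b 2)` back out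
    -- costs a sign past the single map `J ρ`, but none past the pair `J x`, `J y`.
    have e1 : G.J (b 1) (G.J (b 0) (G.J ρ z)) = -G.J (b 2) (G.J ρ z) := by
      rw [hG.J_J_of_orthogonal (hbρ 0), map_neg, hG.J_J_of_orthogonal (hbρ 1), h10,
        hG.J_J_of_orthogonal (hbρ 2)]
    have e2 : G.J (b 1) (G.J (b 0) (G.J ρ z)) = G.J (b 2) (G.J ρ z) := by
      rw [← hρ]
      simp only [hG.J_J_of_orthogonal (hbx _), hG.J_J_of_orthogonal (hby _), map_neg, neg_neg, h10]
    have e3 : G.J (b 2) (G.J ρ z) = 0 := by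
      linear_combination (norm := module) (1 / 2 : ℝ) • (e1 - e2)
    have hne : ∀ {τ : v}, ‖τ‖ = 1 → τ ≠ 0 := fun hτ => by
      rw [← norm_ne_zero_iff, hτ]; exact one_ne_zero
    by_contra hy0
    rw [← hρ] at e3
    refine hne (hb.1 2) (hG.eq_zero_of_J_eq_zero ?_ e3)
    intro e4
    refine hne hx (hG.eq_zero_of_J_eq_zero ?_ e4)
    intro e5
    exact hy0 (hG.eq_zero_of_J_eq_zero hz0 e5)
  refine ⟨B, hz, B.orthonormal, ?_, ?_, ?_, ?_⟩ <;> rw [hB]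
  exacts [h10, ht 0, ht 1, ht 2]

/-- When `v` has dimension three, the relation `J σ₁ J σ₀ = J σ₂` at one vector holds everywhere. -/
theorem J_J_eq_of_basis {z : h} (hz : ‖z‖ = 1) (B : OrthonormalBasis (Fin 3) ℝ v)
    (h10 : G.J (B 1) (G.J (B 0) z) = G.J (B 2) z) (w : h) :
    G.J (B 1) (G.J (B 0) w) = G.J (B 2) w := by
  have hB : ∀ i j, i ≠ j → ⟪B i, B j⟫ = 0 := fun i j hij => B.orthonormal.2 hij
  have hsq : ∀ w, G.J (B 2) (G.J (B 2) w) = -w := fun w => by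
    rw [hG.J_J_self, B.orthonormal.1]; simp
  have heig : ∀ w, ∃ c : ℝ, G.J (B 1) (G.J (B 0) w) = c • G.J (B 2) w := by
    intro w
    rcases eq_or_ne w 0 with rfl | hw
    · exact ⟨0, by simp⟩
    obtain ⟨ρ, hρ⟩ := exists_J_J_eq hG hJ (hB 1 0 (by decide)) w
    have hw2 : ‖w‖ ^ 2 ≠ 0 := pow_ne_zero 2 (norm_ne_zero_iff.mpr hw)
    have h0 : ⟪B 0, ρ⟫ = 0 := by
      have := hG.inner_J_J (B 0) ρ w
      rw [← hρ, real_inner_comm, inner_J_self] at this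
      exact (mul_eq_zero.mp this.symm).resolve_right hw2
    have h1 : ⟪B 1, ρ⟫ = 0 := by
      have := hG.inner_J_J (B 1) ρ w
      rw [← hρ, hG.inner_J_J_self, real_inner_comm, inner_J_self, mul_zero] at this
      exact (mul_eq_zero.mp this.symm).resolve_right hw2
    refine ⟨B.repr ρ 2, ?_⟩
    rw [hρ, J_eq_sum B, Fin.sum_univ_three, B.repr_apply_apply, B.repr_apply_apply, h0, h1]
    simp
  -- The factor in `heig` may depend on `w`, but a linear map for which every vector is an
  -- eigenvector is a scalar. Its value `-1` is read off at `z`.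
  obtain ⟨a, ha⟩ := (G.J (B 2) ∘ₗ G.J (B 1) ∘ₗ
    G.J (B 0)).exists_eq_smul_id_of_forall_notLinearIndependent fun w hw => by
      obtain ⟨c, hc⟩ := heig w
      rw [LinearIndependent.pair_iff] at hw
      have := hw c 1 (by simp [hc, hsq])
      exact one_ne_zero this.2
  have ha' : ∀ w, G.J (B 2) (G.J (B 1) (G.J (B 0) w)) = a • w := fun w => LinearMap.congr_fun ha w
  have h1 := ha' z
  rw [h10, hsq] at h1
  have ha1 : a = -1 := by
    have h2 : (a + 1) • z = 0 := by rw [add_smul, ← h1]; simp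
    have hz0 : z ≠ 0 := by rw [← norm_ne_zero_iff, hz]; exact one_ne_zero
    linarith [(smul_eq_zero.mp h2).resolve_right hz0]
  have h3 := congrArg (G.J (B 2)) (ha' w)
  rw [hsq, ha1, map_smul, neg_one_smul] at h3
  exact neg_injective h3

/-- Groups of Heisenberg type with the `J²` condition, other than the octonionic one. -/
theorem propertyH_and_classification (hO : ¬ G.IsIsometricTo octonionicHeisenberg) :
    G.PropertyH ∧ (Module.finrank ℝ v = 0 ∨
      (Module.finrank ℝ v = 1 ∧ ∃ n : ℕ, 0 < n ∧ ∃ e : h ≃ₗᵢ[ℝ] PiLp 2 (fun _ : Fin n => ℂ),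
        ∀ S : h ≃ₗᵢ[ℝ] h, S ∈ G.invariantOrthogonalGroup ↔ IsUnitaryIn e S) ∨
      (Module.finrank ℝ v = 3 ∧ ∃ n : ℕ, 0 < n ∧ ∃ e : h ≃ₗᵢ[ℝ] PiLp 2 (fun _ : Fin n => ℍ[ℝ]),
        ∀ S : h ≃ₗᵢ[ℝ] h, S ∈ G.invariantOrthogonalGroup ↔ IsUnitaryIn e S)) := by
  have hfin : ∀ {n : ℕ}, OrthonormalBasis (Fin n) ℝ v → Module.finrank ℝ v = n := fun B => by
    rw [Module.finrank_eq_card_basis B.toBasis, Fintype.card_fin]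
  rcases subsingleton_or_nontrivial v with hv | hv
  · exact ⟨propertyH_of_subsingleton, Or.inl Module.finrank_zero_of_subsingleton⟩
  have : Nontrivial h := G.nontrivial_of_nontrivial
  obtain ⟨σ, hσ⟩ := exists_norm_eq v (zero_le_one (α := ℝ))
  obtain ⟨z, hz⟩ := exists_norm_eq h (zero_le_one (α := ℝ))
  have hz0 : z ≠ 0 := by rw [← norm_ne_zero_iff, hz]; exact one_ne_zero
  have o1 : Orthonormal ℝ ![σ] := ⟨fun i => by simpa using hσ, fun i j hij =>
    (hij (Subsingleton.elim i j)).elim⟩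
  rcases o1.exists_basis_or_extend with ⟨B, -⟩ | ⟨τ, hτ, hστ⟩
  · obtain ⟨h1, h2⟩ := propertyH_and_unitary_complex hG B
    exact ⟨h1, Or.inr (Or.inl ⟨hfin B, h2⟩)⟩
  replace hστ : ⟪σ, τ⟫ = 0 := hστ 0
  have hτσ : ⟪τ, σ⟫ = 0 := (real_inner_comm _ _).trans hστ
  -- The product of two orthogonal directions is a third one, so `v` cannot have dimension two.
  obtain ⟨ρ, hρ⟩ := exists_J_J_eq hG hJ hτσ z
  have hip := hG.inner_eq_of_norm_eq_one hz
  have hρ1 : ‖ρ‖ = 1 := by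
    have := hG.norm_J ρ z
    rw [← hρ, hG.norm_J, hG.norm_J, hz, hσ, hτ] at this
    linarith
  have hσρ : ⟪σ, ρ⟫ = 0 := by rw [hip, ← hρ, real_inner_comm, inner_J_self]
  have hτρ : ⟪τ, ρ⟫ = 0 := by
    rw [hip, ← hρ, hG.inner_J_J_self, real_inner_comm, inner_J_self, mul_zero]
  have o3 : Orthonormal ℝ ![σ, τ, ρ] := by
    refine ⟨fun i => ?_, fun i j hij => ?_⟩
    · fin_cases i <;> simp [hσ, hτ, hρ1]
    · fin_cases i <;> fin_cases j <;>
        first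
        | exact absurd rfl hij
        | assumption
        | exact (real_inner_comm _ _).trans hσρ
        | exact (real_inner_comm _ _).trans hτρ
  rcases o3.exists_basis_or_extend with ⟨B, hB⟩ | ⟨μ, hμ, hμ'⟩
  · obtain ⟨h1, h2⟩ := propertyH_and_unitary_quaternion hG B
      (J_J_eq_of_basis hG hJ hz B (by rw [hB]; exact hρ))
    exact ⟨h1, Or.inr (Or.inr ⟨hfin B, h2⟩)⟩
  -- A fourth direction `μ` yields an octonionic frame and also leaves no room in `h` beyond `ℝ z +
  -- J v z`, so the group is the excluded one.
  · refine absurd ?_ hO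
    obtain ⟨B, hB⟩ := exists_octonionicAt hG hJ hz o3 hρ hμ hμ'
    have hne : ∀ {τ : v}, ‖τ‖ = 1 → τ ≠ 0 := fun hτ => by
      rw [← norm_ne_zero_iff, hτ]; exact one_ne_zero
    exact isIsometricTo_octonionicHeisenberg hG hB fun w hzw hb =>
      eq_zero_of_bracket_eq_zero hG hJ hz0 hτσ hρ (hne hρ1) (hne hμ) (hμ' 1) (hμ' 0) (hμ' 2) hzw hb

end StratifiedAlgebra

theorem proposition1p5 :
    -- every group of Iwasawa type other than the octonionic one
    (∀ (h v : Type*) [NormedAddCommGroup h] [InnerProductSpace ℝ h] [FiniteDimensional ℝ h]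
        [NormedAddCommGroup v] [InnerProductSpace ℝ v] [FiniteDimensional ℝ v]
        (G : StratifiedAlgebra h v),
        G.IsIwasawaType → ¬ G.IsIsometricTo octonionicHeisenberg →
          G.PropertyH ∧
          -- abelian, or the commuting group is `U(n)`, or it is `Sp(n)`
          (Module.finrank ℝ v = 0 ∨
            (Module.finrank ℝ v = 1 ∧ ∃ n : ℕ, 0 < n ∧ ∃ e : h ≃ₗᵢ[ℝ] PiLp 2 (fun _ : Fin n => ℂ),
              ∀ S : h ≃ₗᵢ[ℝ] h, S ∈ G.invariantOrthogonalGroup ↔ IsUnitaryIn e S) ∨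
            (Module.finrank ℝ v = 3 ∧ ∃ n : ℕ, 0 < n ∧ ∃ e : h ≃ₗᵢ[ℝ] PiLp 2 (fun _ : Fin n => ℍ[ℝ]),
              ∀ S : h ≃ₗᵢ[ℝ] h, S ∈ G.invariantOrthogonalGroup ↔ IsUnitaryIn e S))) ∧
    -- the octonionic Heisenberg group
    (octonionicHeisenberg.IsHeisenbergType ∧
      Module.finrank ℝ (Octonion × Octonion.imaginary) = 15 ∧
      ¬ octonionicHeisenberg.PropertyH ∧
      (∀ S : Octonion ≃ₗᵢ[ℝ] Octonion, S ∈ octonionicHeisenberg.invariantOrthogonalGroup ↔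
        (S = 1 ∨ S = LinearIsometryEquiv.neg ℝ)) ∧
      -- the centralizer of `Spin(7)` in `SO(8)`
      (∀ S : Octonion ≃ₗᵢ[ℝ] Octonion,
        (LinearMap.det (S.toLinearEquiv : Octonion →ₗ[ℝ] Octonion) = 1 ∧
          S ∈ Subgroup.centralizer (spinSeven : Set (Octonion ≃ₗᵢ[ℝ] Octonion))) ↔
        (S = 1 ∨ S = LinearIsometryEquiv.neg ℝ))) := by
  refine ⟨?_, Octonion.isHeisenbergType, ?_, Octonion.not_propertyH, Octonion.commute_iff, ?_⟩
  · intro h v _ _ _ _ _ _ G hI hO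
    exact StratifiedAlgebra.propertyH_and_classification hI.1 hI.jSquareCondition hO
  · rw [Module.finrank_prod, Octonion.finrank_eq, Octonion.finrank_imaginary]
  · intro S
    rw [Octonion.mem_centralizer_spinSeven_iff]
    exact ⟨fun hS => hS.2, fun hS => ⟨Octonion.det_eq_one S hS, hS⟩⟩
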